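/- **Setting.** Let $\mathbb R^2_\star=\mathbb R^2\setminus\{(0,0)\}$. Let $\Omega=\{(r\cos\theta,r\sin\theta): r>0,\ \theta_1<\theta<\theta_2\}$ be an open cone with vertex at the origin and opening angle $\alpha(\Omega)=\theta_2-\theta_1\in(\pi,2\pi]$ (for $\alpha(\Omega)=2\pi$ this is the plane minus a closed ray). A smooth *radial self-similar solution* in an open cone $D\subset\mathbb R^2_\star$ is a triple $(u,v,p)\in C^\infty(D)^3$ such that, with $\mathbf U=(u,v)$, $$\operatorname{div}(\mathbf U\otimes\mathbf U)-\Delta\mathbf U+\nabla p=0,\qquad \operatorname{div}\mathbf U=0\qquad\text{in }D,$$ $\mathbf U(x,y)=\lambda\,\mathbf U(\lambda x,\lambda y)$ and $p(x,y)=\lambda^2p(\lambda x,\lambda y)$ for all $\lambda>0$, and $xv=yu$ in $D$. It is *nontrivial* if $\mathbf U\not\equiv0$. **The profiles.** Let $F(\varphi,k)=\int_0^\varphi(1-k^2\sin^2t)^{-1/2}\,dt$, $K(k)=F(\pi/2,k)$, and let $\operatorname{am}(\cdot,k)$ be the inverse of $F(\cdot,k)$. For $(C_1,C_2)\in\mathbb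 R^2$ put $\mathcal P(h)=h^3+6h^2+6C_1h+C_2$, and for $C_1\le2$ put $s=\sqrt{2(2-C_1)}$ and $L_\pm=12C_1-16\pm4(2-C_1)s$. A *table profile* for $(C_1,C_2)$ is one of the following functions $f$ of the angle $\theta$, where $C\in\mathbb R$ is arbitrary except in the first row: - $f=C$, where $\mathcal P(C)=0$ and $2C+C_1=-C^2/2$; - if $C_1>2$, or $C_1=2$ and $C_2\ne8$, or $C_1<2$ and $C_2\notin[L_-,L_+]$: $f=\alpha-\beta\cot^2\!\Big(\tfrac12\operatorname{am}\big(\tfrac{\sqrt{6\beta}}3\theta+\sqrt\beta\,C,\ \sqrt{\tfrac{\beta-m+\alpha}{2\beta}}\big)\Big)$, where $\alpha$ and $m\pm ni$ ($\alpha,m,n\in\mathbb R$, $n\neq0$) are the roots of $\mathcal P$ and $\beta=\sqrt{(m-\alpha)^2+n^2}$; - if $(C_1,C_2)=(2,8)$: $f=-2-\dfrac6{(\theta+C)^2}$; - if $C_1<2$ and $L_-<C_2<L_+$: with $a<b<c$ the roots of $\mathcal P$ and $A(\theta)=\operatorname{am}\big(\sqrt{\tfrac{c-a}6}\,\theta+\sqrt{c-a}\,C,\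 \sqrt{\tfrac{c-b}{c-a}}\big)$, either $f=c-(c-b)\sin^2A(\theta)$ or $f=a-(b-a)\tan^2A(\theta)$; - if $C_1<2$ and $C_2=L_+$: $f=-2-2s-3s\tan^2\!\Big(\sqrt[4]{\tfrac{2-C_1}2}\,\theta+C\Big)$; - if $C_1<2$ and $C_2=L_-$: $f=-2+2s-3s\tanh^2G(\theta)$ or $f=-2+2s-3s\coth^2G(\theta)$, where $G(\theta)=\tfrac{\sqrt[4]{2-C_1}}2\big(\sqrt[4]8\,\theta+C\big)$. **Theorem.** Let $(u,v,p)$ be a nontrivial smooth radial self-similar solution in $\Omega$. 1. There are $C_1,C_2\in\mathbb R$, a table profile $f$ for $(C_1,C_2)$ and a real-analytic function $\widetilde\kappa$ on $\Omega$ such that, in $\Omega$, $$u=\frac{x}{x^2+y^2}\,\widetilde\kappa,\qquad v=\frac{y}{x^2+y^2}\,\widetilde\kappa,\qquad p=\frac{2}{x^2+y^2}\,\widetilde\kappa+\frac{C_1}{x^2+y^2},$$ and $\widetilde\kappa$ is the real-analytic extension to $\Omega$ of $\kappa(x,y)=f(\arctan(y/x))$: the two functions agree on some nonempty open subcone of $\Omega\cap\{x>0\}$.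 Moreover, for some $k\in\mathbb Z$, $\widetilde\kappa(r\cos\theta,r\sin\theta)=f(\theta-2\pi k)$ for all $r>0$ and $\theta\in(\theta_1,\theta_2)$. 2. Suppose that $(u,v,p)$ extends smoothly to $\mathbb R^2_\star$: there is $(U,V,P)\in C^\infty(\mathbb R^2_\star)^3$ that equals $(u,v,p)$ in $\Omega$ and, in case $\alpha(\Omega)<2\pi$, is a radial self-similar solution in $\mathbb R^2_\star$. Then $(U,V,P)$ is a classical radial Jeffery–Hamel solution. That is, either $$(U,V,P)=\Big(\frac{Ax}{x^2+y^2},\ \frac{Ay}{x^2+y^2},\ -\frac{A^2}{2(x^2+y^2)}\Big)\quad\text{for some constant }A\in\mathbb R,$$ or there are an integer $n\ge1$, constants $C_1,\theta_0\in\mathbb R$ and a $2\pi/n$-periodic elliptic function $f$ such that, for all $r>0$ and $\theta\in\mathbb R$, at the point $(r\cos\theta,r\sin\theta)$, $$(U,V)=\frac{f(\theta-\theta_0)}r(\cos\theta,\sin\theta),\qquad P=\frac{2f(\theta-\theta_0)+C_1}{r^2},\qquad 4+\frac1\pi\int_0^{2\pi}f\,d\theta<n^2.$$ Here, for some $C_2$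 with $C_1<2$ and $L_-<C_2<L_+$ and some $C\in\mathbb R$, $f=c-(c-b)\sin^2A(\theta)$ is the bounded table profile above, and its roots $a<b<c$ satisfy $\pi\sqrt{\tfrac{c-a}6}=n\,K\Big(\sqrt{\tfrac{c-b}{c-a}}\Big)$. -/

import Mathlib

open Real Set
open scoped ContDiff

noncomputable section

namespace JefferyHamel

/-! ### Cones -/

/-- The punctured plane. -/
def puncturedPlane : Set (ℝ × ℝ) := {q | q ≠ 0}

/-- The open cone with vertex at the origin bounded by the rays of polar angles `θ₁ < θ₂`. For
`θ₂ - θ₁ ≤ 2 * π` its opening angle is `θ₂ - θ₁`; for `θ₂ - θ₁ = 2 * π` it is the plane with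
a closed ray removed. -/
def sector (θ₁ θ₂ : ℝ) : Set (ℝ × ℝ) :=
  {q | ∃ r : ℝ, 0 < r ∧ ∃ θ ∈ Ioo θ₁ θ₂, q = (r * cos θ, r * sin θ)}

/-- The squared Euclidean distance to the origin. -/
def rsq (q : ℝ × ℝ) : ℝ := q.1 ^ 2 + q.2 ^ 2

/-! ### The stationary Navier–Stokes equations -/

/-- Partial derivative in the first variable. -/
def dX (w : ℝ × ℝ → ℝ) (q : ℝ × ℝ) : ℝ := fderiv ℝ w q (1, 0)

/-- Partial derivative in the second variable. -/
def dY (w : ℝ × ℝ → ℝ) (q : ℝ × ℝ) : ℝ := fderiv ℝ w q (0, 1)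

/-- The Laplacian. -/
def lap (w : ℝ × ℝ → ℝ) (q : ℝ × ℝ) : ℝ := dX (dX w) q + dY (dY w) q

/-- `div (U ⊗ U) - Δ U + ∇ p = 0` and `div U = 0` on `Ω`, for `U = (u, v)`. -/
def SolvesNS (Ω : Set (ℝ × ℝ)) (u v p : ℝ × ℝ → ℝ) : Prop :=
  ∀ q ∈ Ω,
    dX (fun z => u z * u z) q + dY (fun z => u z * v z) q - lap u q + dX p q = 0 ∧
    dX (fun z => v z * u z) q + dY (fun z => v z * v z) q - lap v q + dY p q = 0 ∧
    dX u q + dY v q = 0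

/-- Invariance under `(U, p) ↦ (s U (s ·), s² p (s ·))` for all `s > 0`, on a cone `Ω`. -/
def SelfSimilar (Ω : Set (ℝ × ℝ)) (u v p : ℝ × ℝ → ℝ) : Prop :=
  ∀ s : ℝ, 0 < s → ∀ q ∈ Ω,
    u q = s * u (s • q) ∧ v q = s * v (s • q) ∧ p q = s ^ 2 * p (s • q)

/-- Smoothness of the velocity and the pressure. -/
def SmoothOn (Ω : Set (ℝ × ℝ)) (u v p : ℝ × ℝ → ℝ) : Prop :=
  ContDiffOn ℝ ∞ u Ω ∧ ContDiffOn ℝ ∞ v Ω ∧ ContDiffOn ℝ ∞ p Ω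

/-- Smooth radial self-similar solutions of the stationary Navier–Stokes equations in an open
cone `Ω`. -/
structure IsRadialSelfSimilarSolution (Ω : Set (ℝ × ℝ)) (u v p : ℝ × ℝ → ℝ) : Prop where
  smooth : SmoothOn Ω u v p
  solves : SolvesNS Ω u v p
  selfSimilar : SelfSimilar Ω u v p
  radial : ∀ q ∈ Ω, q.1 * v q = q.2 * u q

/-! ### Elliptic integrals and the Jacobi amplitude -/

/-- The incomplete elliptic integral of the first kind `F(φ, k)`. -/
def ellipticF (φ k : ℝ) : ℝ := ∫ t in (0 : ℝ)..φ, 1 / √(1 - k ^ 2 * sin t ^ 2)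

/-- The complete elliptic integral of the first kind `K(k)`. -/
def ellipticK (k : ℝ) : ℝ := ellipticF (π / 2) k

/-- The Jacobi amplitude `am(m, k)`, the inverse of `φ ↦ F(φ, k)`, which for `0 ≤ k < 1` is a
bijection of `ℝ`. -/
def jacobiAm (m k : ℝ) : ℝ := Function.invFun (fun φ => ellipticF φ k) m

/-! ### The parameter regions -/

/-- The cubic `h³ + 6 h² + 6 C₁ h + C₂`. -/
def cubic (C₁ C₂ h : ℝ) : ℝ := h ^ 3 + 6 * h ^ 2 + 6 * C₁ * h + C₂

/-- `L₊`. -/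
def Lplus (C₁ : ℝ) : ℝ := 12 * C₁ - 16 + 4 * (2 - C₁) * √(2 * (2 - C₁))

/-- `L₋`. -/
def Lminus (C₁ : ℝ) : ℝ := 12 * C₁ - 16 - 4 * (2 - C₁) * √(2 * (2 - C₁))

/-- Region `I`. -/
def regionI : Set (ℝ × ℝ) :=
  {c | 2 < c.1 ∨ (c.1 = 2 ∧ c.2 ≠ 8) ∨ (c.1 < 2 ∧ (Lplus c.1 < c.2 ∨ c.2 < Lminus c.1))}

/-- The point `P₀`. -/
def pointP0 : Set (ℝ × ℝ) := {(2, 8)}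

/-- Region `II`. -/
def regionII : Set (ℝ × ℝ) := {c | c.1 < 2 ∧ Lminus c.1 < c.2 ∧ c.2 < Lplus c.1}

/-- The curve `Γ₊`. -/
def gammaPlus : Set (ℝ × ℝ) := {c | c.1 < 2 ∧ c.2 = Lplus c.1}

/-- The curve `Γ₋`. -/
def gammaMinus : Set (ℝ × ℝ) := {c | c.1 < 2 ∧ c.2 = Lminus c.1}

/-! ### The profiles, as functions of the angle -/

/-- Profile of region `I`. -/
def profile1 (α β m C θ : ℝ) : ℝ :=
  α - β * cot (1 / 2 * jacobiAm (√(6 * β) / 3 * θ + √β * C) (√((β - m + α) / (2 * β)))) ^ 2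

/-- Profile of the point `P₀`. -/
def profile2 (C θ : ℝ) : ℝ := -2 - 6 / (θ + C) ^ 2

/-- Bounded profile of region `II`. -/
def profile3 (a b c C θ : ℝ) : ℝ :=
  c - (c - b) * sin (jacobiAm (√((c - a) / 6) * θ + √(c - a) * C) (√((c - b) / (c - a)))) ^ 2

/-- Unbounded profile of region `II`. -/
def profile4 (a b c C θ : ℝ) : ℝ :=
  a - (b - a) * tan (jacobiAm (√((c - a) / 6) * θ + √(c - a) * C) (√((c - b) / (c - a)))) ^ 2

/-- Profile of the curve `Γ₊`. -/
def profile5 (C₁ C θ : ℝ) : ℝ :=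
  -2 - 2 * √(2 * (2 - C₁))
    - 3 * √(2 * (2 - C₁)) * tan (((2 - C₁) / 2) ^ (1 / 4 : ℝ) * θ + C) ^ 2

/-- Bounded profile of the curve `Γ₋`. -/
def profile6 (C₁ C θ : ℝ) : ℝ :=
  -2 + 2 * √(2 * (2 - C₁))
    - 3 * √(2 * (2 - C₁)) *
      tanh ((2 - C₁) ^ (1 / 4 : ℝ) / 2 * ((8 : ℝ) ^ (1 / 4 : ℝ) * θ + C)) ^ 2

/-- Unbounded profile of the curve `Γ₋`; here `coth = 1 / tanh`. -/
def profile7 (C₁ C θ : ℝ) : ℝ :=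
  -2 + 2 * √(2 * (2 - C₁))
    - 3 * √(2 * (2 - C₁)) *
      (1 / tanh ((2 - C₁) ^ (1 / 4 : ℝ) / 2 * ((8 : ℝ) ^ (1 / 4 : ℝ) * θ + C))) ^ 2

/-- `IsTableProfile C₁ C₂ f`: the function `(x, y) ↦ f (arctan (y / x))` is one of the profiles of
the classification table for the parameters `(C₁, C₂)`. -/
inductive IsTableProfile (C₁ C₂ : ℝ) : (ℝ → ℝ) → Prop
  | singular (C : ℝ) (hC : cubic C₁ C₂ C = 0) (hp : 2 * C + C₁ = -C ^ 2 / 2) :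
      IsTableProfile C₁ C₂ (fun _ => C)
  | regI (h : (C₁, C₂) ∈ regionI) (α β m n C : ℝ) (hn : n ≠ 0) (h1 : -2 * m - α = 6)
      (h2 : m ^ 2 + n ^ 2 + 2 * α * m = 6 * C₁) (h3 : -α * (m ^ 2 + n ^ 2) = C₂)
      (hβ : β = √((m - α) ^ 2 + n ^ 2)) :
      IsTableProfile C₁ C₂ (profile1 α β m C)
  | ptP0 (h : (C₁, C₂) ∈ pointP0) (C : ℝ) : IsTableProfile C₁ C₂ (profile2 C)
  | regIIbounded (h : (C₁, C₂) ∈ regionII) (a b c C : ℝ) (hab : a < b) (hbc : b < c)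
      (ha : cubic C₁ C₂ a = 0) (hb : cubic C₁ C₂ b = 0) (hc : cubic C₁ C₂ c = 0) :
      IsTableProfile C₁ C₂ (profile3 a b c C)
  | regIIunbounded (h : (C₁, C₂) ∈ regionII) (a b c C : ℝ) (hab : a < b) (hbc : b < c)
      (ha : cubic C₁ C₂ a = 0) (hb : cubic C₁ C₂ b = 0) (hc : cubic C₁ C₂ c = 0) :
      IsTableProfile C₁ C₂ (profile4 a b c C)
  | gamPlus (h : (C₁, C₂) ∈ gammaPlus) (C : ℝ) : IsTableProfile C₁ C₂ (profile5 C₁ C)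
  | gamMinusBounded (h : (C₁, C₂) ∈ gammaMinus) (C : ℝ) : IsTableProfile C₁ C₂ (profile6 C₁ C)
  | gamMinusUnbounded (h : (C₁, C₂) ∈ gammaMinus) (C : ℝ) : IsTableProfile C₁ C₂ (profile7 C₁ C)

/-! ### Classical radial Jeffery–Hamel solutions -/

/-- `f` is a periodic profile of `sn²` type for the parameter `C₁`, whose minimal period is
`2 * π / n`: half a period `π / n` of the angle corresponds to the argument `K(k)`. -/
def IsPeriodicEllipticProfile (C₁ : ℝ) (n : ℕ) (f : ℝ → ℝ) : Prop :=
  ∃ C₂ a b c C : ℝ, (C₁, C₂) ∈ regionII ∧ a < b ∧ b < c ∧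
    cubic C₁ C₂ a = 0 ∧ cubic C₁ C₂ b = 0 ∧ cubic C₁ C₂ c = 0 ∧
    π * √((c - a) / 6) = n * ellipticK (√((c - b) / (c - a))) ∧
    f = profile3 a b c C

/-- The classical radial Jeffery–Hamel solutions in the punctured plane: either the angular profile
is constant, or it is a periodic elliptic function obeying the flux bound. -/
def IsRadialJefferyHamel (u v p : ℝ × ℝ → ℝ) : Prop :=
  (∃ A : ℝ, ∀ q ∈ puncturedPlane,
    u q = A * q.1 / rsq q ∧ v q = A * q.2 / rsq q ∧ p q = -A ^ 2 / (2 * rsq q)) ∨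
  (∃ (n : ℕ) (C₁ θ₀ : ℝ) (f : ℝ → ℝ), 0 < n ∧
    IsPeriodicEllipticProfile C₁ n f ∧
    Function.Periodic f (2 * π / n) ∧
    4 + (∫ θ in (0 : ℝ)..(2 * π), f θ) / π < (n : ℝ) ^ 2 ∧
    ∀ r θ : ℝ, 0 < r →
      u (r * cos θ, r * sin θ) = f (θ - θ₀) / r * cos θ ∧
      v (r * cos θ, r * sin θ) = f (θ - θ₀) / r * sin θ ∧
      p (r * cos θ, r * sin θ) = 2 * f (θ - θ₀) / r ^ 2 + C₁ / r ^ 2)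

end JefferyHamel

end

/-!
In polar coordinates a radial self-similar solution is `g(θ) / r` times the radial unit vector, with
pressure `Π(θ) / r²`. Degree counting turns the momentum equations into `Π' = 2 g'` and
`g'' = -g² - 2 Π`, so `Π = 2 g + C₁` and `g'' + g² + 4 g + 2 C₁ = 0`
(`IsRadialSelfSimilarSolution.exists_profile`). This equation has the first integral
`g'² = -(2/3) 𝒫(g)`, where `𝒫` is the cubic with parameters `C₁, C₂`.

For each configuration of the roots of `𝒫`, every value `h` with `𝒫(h) < 0` is taken by a table
profile, which is a solution off its poles with the same first integral. All profiles are `P - Q w²`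
or `P - Q / w²` where `w'²` is a polynomial in `w²` and `w` is a circular, hyperbolic or Jacobi
function (`IsModel.of_sq`, `IsModel.of_inv_sq`). Evenness supplies either sign of the derivative, so
a nonconstant solution shares its Cauchy data at one point with a translate of a profile. Uniqueness
propagates the equality over the interval, and poles are not met because the solution stays locally
bounded (`IsModel.exists_eq_translate`, `exists_tableModel`). Analyticity of the Jacobi amplitude
comes from a holomorphic primitive of the integrand of `F(·, k)`.

In the punctured plane the profile lives on `ℝ` and has period `2 π`. This excludes poles and the
homoclinic `tanh²` profile, and forces `2 π` to be a multiple of the period of the remaining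
`sn²` profile `h`. For the flux bound put the maximum of `h` at `0`, let the minimal period be
`2 π / n`, and set `d(t) = h(t) - h(π/n - t)`, `e(t) = h(t) + h(π/n - t) + 4`. Then `d'' = -e d`, so
`n² - e` is orthogonal to `d cos (n t)` on the quarter period `[0, π/(2n)]`. Both this weight and
`e` decrease there; for `e` this uses that `h(t) - a` and `h(π/n - t) - a` have a constant product
(`profile3_mul_reflect`). By Chebyshev's inequality the mean of `e` is less than `n²`, which is the
bound (`profile3_flux_lt`). A sector of opening `2 π` is dense in the punctured plane, so there the
equations extend by continuity.
-/

namespace JefferyHamel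

/-! ### Elliptic integrals and the Jacobi amplitude -/

/-- The delta amplitude `√(1 - k² sin² φ)`, the reciprocal of the derivative of `F(·, k)`. -/
noncomputable def deltaAmp (k φ : ℝ) : ℝ := √(1 - k ^ 2 * sin φ ^ 2)

section Amplitude

variable {k : ℝ}

lemma one_sub_sq_mul_sin_sq_pos (hk : k ^ 2 < 1) (φ : ℝ) : 0 < 1 - k ^ 2 * sin φ ^ 2 := by
  nlinarith [sin_sq_le_one φ, sq_nonneg (sin φ), sq_nonneg k]

lemma deltaAmp_pos (hk : k ^ 2 < 1) (φ : ℝ) : 0 < deltaAmp k φ :=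
  sqrt_pos.2 (one_sub_sq_mul_sin_sq_pos hk φ)

lemma sq_deltaAmp (hk : k ^ 2 < 1) (φ : ℝ) : deltaAmp k φ ^ 2 = 1 - k ^ 2 * sin φ ^ 2 :=
  sq_sqrt (one_sub_sq_mul_sin_sq_pos hk φ).le

lemma deltaAmp_le_one (k φ : ℝ) : deltaAmp k φ ≤ 1 := by
  refine sqrt_le_one.2 ?_
  nlinarith [mul_nonneg (sq_nonneg k) (sq_nonneg (sin φ))]

lemma continuous_one_div_deltaAmp (hk : k ^ 2 < 1) : Continuous fun φ => 1 / deltaAmp k φ := by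
  refine Continuous.div continuous_const ?_ fun φ => (deltaAmp_pos hk φ).ne'
  unfold deltaAmp
  fun_prop

lemma hasDerivAt_ellipticF (hk : k ^ 2 < 1) (φ : ℝ) :
    HasDerivAt (fun φ => ellipticF φ k) (1 / deltaAmp k φ) φ :=
  intervalIntegral.integral_hasDerivAt_right
    ((continuous_one_div_deltaAmp hk).intervalIntegrable _ _)
    ((continuous_one_div_deltaAmp hk).stronglyMeasurableAtFilter _ _)
    (continuous_one_div_deltaAmp hk).continuousAt

@[simp] lemma ellipticF_zero (k : ℝ) : ellipticF 0 k = 0 := by simp [ellipticF]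

lemma ellipticF_strictMono (hk : k ^ 2 < 1) : StrictMono fun φ => ellipticF φ k :=
  strictMono_of_hasDerivAt_pos (hasDerivAt_ellipticF hk)
    fun φ => one_div_pos.2 (deltaAmp_pos hk φ)

lemma continuous_ellipticF (hk : k ^ 2 < 1) : Continuous fun φ => ellipticF φ k :=
  continuous_iff_continuousAt.2 fun φ => (hasDerivAt_ellipticF hk φ).continuousAt

lemma ellipticF_neg (φ k : ℝ) : ellipticF (-φ) k = -ellipticF φ k := by
  have h := intervalIntegral.integral_comp_neg (a := 0) (b := φ)
    fun t => 1 / √(1 - k ^ 2 * sin t ^ 2)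
  simp only [sin_neg, neg_sq, neg_zero] at h
  rw [ellipticF, ellipticF, h, intervalIntegral.integral_symm]

lemma self_le_ellipticF (hk : k ^ 2 < 1) {φ : ℝ} (hφ : 0 ≤ φ) : φ ≤ ellipticF φ k := by
  have hm : Monotone fun φ => ellipticF φ k - φ :=
    monotone_of_hasDerivAt_nonneg (fun φ => (hasDerivAt_ellipticF hk φ).sub (hasDerivAt_id φ))
      fun φ => sub_nonneg.2 ((one_le_div (deltaAmp_pos hk φ)).2 (deltaAmp_le_one k φ))
  simpa using hm hφ

lemma ellipticF_surjective (hk : k ^ 2 < 1) : Function.Surjective fun φ => ellipticF φ k := by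
  refine (continuous_ellipticF hk).surjective ?_ ?_
  · exact Filter.tendsto_atTop_mono' _ ((Filter.eventually_ge_atTop 0).mono
      fun φ hφ => self_le_ellipticF hk hφ) Filter.tendsto_id
  · refine Filter.tendsto_atBot_mono' _ ((Filter.eventually_le_atBot 0).mono
      fun φ hφ => ?_) Filter.tendsto_id
    have h := self_le_ellipticF hk (neg_nonneg.2 hφ)
    rw [ellipticF_neg] at h
    simpa using h

@[simp] lemma jacobiAm_ellipticF (hk : k ^ 2 < 1) (φ : ℝ) : jacobiAm (ellipticF φ k) k = φ :=
  Function.leftInverse_invFun (ellipticF_strictMono hk).injective φ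

@[simp] lemma ellipticF_jacobiAm (hk : k ^ 2 < 1) (m : ℝ) : ellipticF (jacobiAm m k) k = m :=
  Function.rightInverse_invFun (ellipticF_surjective hk) m

lemma jacobiAm_strictMono (hk : k ^ 2 < 1) : StrictMono fun m => jacobiAm m k := by
  intro x y h
  by_contra! hle
  have := (ellipticF_strictMono hk).monotone hle
  simp only [ellipticF_jacobiAm hk] at this
  exact absurd h this.not_gt

lemma jacobiAm_neg (hk : k ^ 2 < 1) (m : ℝ) : jacobiAm (-m) k = -jacobiAm m k :=
  (ellipticF_strictMono hk).injective (by simp [hk, ellipticF_neg])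

lemma jacobiAm_zero (hk : k ^ 2 < 1) : jacobiAm 0 k = 0 := by
  simpa using jacobiAm_ellipticF hk 0

/-- Near the real axis the integrand of `F(·, k)` is the restriction of a holomorphic function,
which has a primitive on discs. -/
lemma analyticAt_ellipticF (hk : k ^ 2 < 1) (x : ℝ) :
    AnalyticAt ℝ (fun φ => ellipticF φ k) x := by
  let q : ℂ → ℂ := fun z => 1 - (k : ℂ) ^ 2 * Complex.sin z ^ 2
  have hq_real (t : ℝ) : q t = ((1 - k ^ 2 * sin t ^ 2 : ℝ) : ℂ) := by
    simp [q]
  have hq_cont : Continuous q := by fun_prop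
  have hq_diff : Differentiable ℂ q := by fun_prop
  have hslit : ∀ᶠ z in nhds (x : ℂ), q z ∈ Complex.slitPlane := by
    refine hq_cont.continuousAt.eventually (Complex.isOpen_slitPlane.mem_nhds ?_)
    rw [hq_real]
    exact Complex.ofReal_mem_slitPlane.2 (one_sub_sq_mul_sin_sq_pos hk x)
  obtain ⟨ε, hε, hball⟩ := Metric.eventually_nhds_iff_ball.1 hslit
  have hdiff : DifferentiableOn ℂ (fun z => q z ^ (-(1 / 2 : ℂ))) (Metric.ball (x : ℂ) ε) :=
    fun z hz => ((hq_diff z).cpow (differentiableAt_const _) (hball z hz)).differentiableWithinAt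
  obtain ⟨Φ, hΦx, hΦ⟩ := (DifferentiableOn.isExactOn_ball hdiff).with_val_at (x : ℂ)
    ((ellipticF x k : ℝ) : ℂ)
  have hmem (t : ℝ) (ht : t ∈ Metric.ball x ε) : (t : ℂ) ∈ Metric.ball (x : ℂ) ε := by
    rw [Metric.mem_ball, Complex.dist_of_im_eq (by simp)]
    simpa using ht
  have hderiv (t : ℝ) (ht : t ∈ Metric.ball x ε) :
      HasDerivAt (fun s : ℝ => (Φ s).re) (1 / deltaAmp k t) t := by
    have h := (hΦ t (hmem t ht)).real_of_complex
    have hval : (q t ^ (-(1 / 2 : ℂ))) = ((1 / deltaAmp k t : ℝ) : ℂ) := by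
      have hp := one_sub_sq_mul_sin_sq_pos hk t
      have hinv : 1 / √(1 - k ^ 2 * sin t ^ 2) = (1 - k ^ 2 * sin t ^ 2) ^ (-(1 / 2) : ℝ) := by
        rw [sqrt_eq_rpow, rpow_neg hp.le, one_div]
      rw [hq_real, deltaAmp, hinv, Complex.ofReal_cpow hp.le]
      norm_num
    rwa [hval, Complex.ofReal_re] at h
  have heq : EqOn (fun φ => ellipticF φ k) (fun s : ℝ => (Φ s).re) (Metric.ball x ε) := by
    refine (convex_ball x ε).eqOn_of_fderivWithin_eq (𝕜 := ℝ) (x := x)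
      (fun t _ => (hasDerivAt_ellipticF hk t).differentiableAt.differentiableWithinAt)
      (fun t ht => (hderiv t ht).differentiableAt.differentiableWithinAt)
      Metric.isOpen_ball.uniqueDiffOn (fun t ht => ?_) (Metric.mem_ball_self hε) ?_
    · rw [fderivWithin_of_isOpen Metric.isOpen_ball ht,
        fderivWithin_of_isOpen Metric.isOpen_ball ht,
        (hasDerivAt_ellipticF hk t).hasFDerivAt.fderiv, (hderiv t ht).hasFDerivAt.fderiv]
    · simp [hΦx]
  have hΦan : AnalyticAt ℝ Φ (x : ℂ) :=
    (DifferentiableOn.analyticAt (fun z hz => (hΦ z hz).differentiableAt.differentiableWithinAt)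
      (Metric.ball_mem_nhds _ hε)).restrictScalars
  have hre : AnalyticAt ℝ (fun s : ℝ => (Φ s).re) x :=
    (Complex.reCLM.analyticAt _).comp (hΦan.comp (Complex.ofRealCLM.analyticAt x))
  exact hre.congr (heq.symm.eventuallyEq_of_mem (Metric.ball_mem_nhds x hε))

lemma analyticAt_jacobiAm (hk : k ^ 2 < 1) (m : ℝ) : AnalyticAt ℝ (fun m => jacobiAm m k) m := by
  have hF := analyticAt_ellipticF hk (jacobiAm m k)
  have hne : deriv (fun φ => ellipticF φ k) (jacobiAm m k) ≠ 0 := by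
    rw [(hasDerivAt_ellipticF hk _).deriv]
    exact (one_div_pos.2 (deltaAmp_pos hk _)).ne'
  have h := (analyticAt_comp_iff_of_deriv_ne_zero (g := fun m => jacobiAm m k) hF hne).1
    (analyticAt_id.congr (Filter.Eventually.of_forall fun φ => (jacobiAm_ellipticF hk φ).symm))
  rwa [ellipticF_jacobiAm hk] at h

lemma hasDerivAt_jacobiAm (hk : k ^ 2 < 1) (m : ℝ) :
    HasDerivAt (fun m => jacobiAm m k) (deltaAmp k (jacobiAm m k)) m := by
  have h := HasDerivAt.of_local_left_inverse (analyticAt_jacobiAm hk m).continuousAt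
    (hasDerivAt_ellipticF hk (jacobiAm m k)) (one_div_pos.2 (deltaAmp_pos hk _)).ne'
    (Filter.Eventually.of_forall fun y => ellipticF_jacobiAm hk y)
  simpa using h

lemma hasDerivAt_deltaAmp (hk : k ^ 2 < 1) (φ : ℝ) :
    HasDerivAt (deltaAmp k) (-(k ^ 2 * sin φ * cos φ) / deltaAmp k φ) φ := by
  have h := ((((hasDerivAt_sin φ).pow 2).const_mul (k ^ 2)).const_sub 1).sqrt
    (one_sub_sq_mul_sin_sq_pos hk φ).ne'
  have hp := (deltaAmp_pos hk φ).ne'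
  refine h.congr_deriv ?_
  change _ / (2 * deltaAmp k φ) = _
  field_simp
  norm_num
  ring

/-- `F(φ + π, k) = F(φ, k) + 2 K(k)`. -/
lemma ellipticF_add_pi (hk : k ^ 2 < 1) (φ : ℝ) :
    ellipticF (φ + π) k = ellipticF φ k + 2 * ellipticK k := by
  have hper (ψ : ℝ) : deltaAmp k (ψ + π) = deltaAmp k ψ := by simp [deltaAmp]
  have hd (ψ : ℝ) : HasDerivAt (fun ψ => ellipticF (ψ + π) k - ellipticF ψ k) 0 ψ := by
    refine (((hasDerivAt_ellipticF hk (ψ + π)).comp_add_const ψ π).fun_sub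
      (hasDerivAt_ellipticF hk ψ)).congr_deriv ?_
    rw [hper, sub_self]
  have hconst := is_const_of_deriv_eq_zero (fun ψ => (hd ψ).differentiableAt)
    fun ψ => (hd ψ).deriv
  have h := hconst φ (-(π / 2))
  simp only [ellipticF_neg] at h
  rw [show -(π / 2) + π = π / 2 by ring] at h
  rw [ellipticK]
  linarith

lemma jacobiAm_add_two_mul_ellipticK (hk : k ^ 2 < 1) (m : ℝ) :
    jacobiAm (m + 2 * ellipticK k) k = jacobiAm m k + π :=
  (ellipticF_strictMono hk).injective (by
    simp [hk, ellipticF_add_pi hk])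

lemma ellipticF_int_mul_pi (hk : k ^ 2 < 1) (j : ℤ) :
    ellipticF (j * π) k = j * (2 * ellipticK k) := by
  induction j using Int.induction_on with
  | zero => simp
  | succ i ih =>
    push_cast at ih ⊢
    rw [add_mul, one_mul, ellipticF_add_pi hk, ih]
    ring
  | pred i ih =>
    have h := ellipticF_add_pi hk (((-(i : ℤ) - 1 : ℤ) : ℝ) * π)
    rw [show (((-(i : ℤ) - 1 : ℤ) : ℝ) * π) + π = ((-(i : ℤ) : ℤ) : ℝ) * π by
      push_cast; ring, ih] at h
    push_cast at h ⊢
    linarith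

lemma ellipticK_pos (hk : k ^ 2 < 1) : 0 < ellipticK k := by
  have h := ellipticF_strictMono hk (show (0 : ℝ) < π / 2 by positivity)
  simpa [ellipticK] using h

end Amplitude

/-! ### The profile equation and its global models -/

/-- `g`, with derivative `g'`, solves the profile equation `g'' + g² + 4 g + 2 C₁ = 0` on `J`. -/
def IsProfileSolution (C₁ : ℝ) (g g' : ℝ → ℝ) (J : Set ℝ) : Prop :=
  ∀ t ∈ J, HasDerivAt g (g' t) t ∧ HasDerivAt g' (-g t ^ 2 - 4 * g t - 2 * C₁) t

/-- A global model for the profile equation with first integral `g'² = -(2/3) 𝒫(g)`: a solution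
`f` off a closed set `S` of poles, at which it tends to `-∞`. Values of `f` on `S` are irrelevant.
Evenness makes both signs of `f'` available at a given value of `f`. -/
structure IsModel (C₁ C₂ : ℝ) (S : Set ℝ) (f f' : ℝ → ℝ) : Prop where
  isClosed : IsClosed S
  tendsto_pole : ∀ s ∈ S, Filter.Tendsto f (nhdsWithin s Sᶜ) Filter.atBot
  analyticAt : ∀ t ∉ S, AnalyticAt ℝ f t
  isSolution : IsProfileSolution C₁ f f' Sᶜ
  energy : ∀ t ∉ S, f' t ^ 2 = -(2 / 3) * cubic C₁ C₂ (f t)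
  neg_notMem : ∀ t ∉ S, -t ∉ S
  even : ∀ t ∉ S, f (-t) = f t

/-- Solutions of the profile equation with the same Cauchy data agree locally. -/
lemma eventually_eq_of_cauchy_data {C₁ t₀ : ℝ} {f f' g g' : ℝ → ℝ} {J : Set ℝ}
    (hJ : J ∈ nhds t₀) (hf : IsProfileSolution C₁ f f' J) (hg : IsProfileSolution C₁ g g' J)
    (h0 : f t₀ = g t₀) (h1 : f' t₀ = g' t₀) :
    ∀ᶠ t in nhds t₀, f t = g t ∧ f' t = g' t := by
  let v : ℝ × ℝ → ℝ × ℝ := fun y => (y.2, -y.1 ^ 2 - 4 * y.1 - 2 * C₁)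
  have hv : ContDiff ℝ 1 v := by fun_prop
  obtain ⟨K, s, hs, hK⟩ := (hv.contDiffAt (x := (f t₀, f' t₀))).exists_lipschitzOnWith
  have key {a a' : ℝ → ℝ} (ha : IsProfileSolution C₁ a a' J) (h0 : (a t₀, a' t₀) = (f t₀, f' t₀)) :
      ∀ᶠ t in nhds t₀, HasDerivAt (fun t => (a t, a' t)) (v (a t, a' t)) t ∧
        (a t, a' t) ∈ s := by
    have hcont : ContinuousAt (fun t => (a t, a' t)) t₀ :=
      ((ha t₀ (mem_of_mem_nhds hJ)).1.continuousAt).prodMk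
        (ha t₀ (mem_of_mem_nhds hJ)).2.continuousAt
    filter_upwards [hJ, hcont.eventually (h0 ▸ hs)] with t ht hts
    exact ⟨(ha t ht).1.prodMk (ha t ht).2, hts⟩
  have := ODE_solution_unique_of_eventually (v := fun _ => v) (s := fun _ => s)
    (Filter.Eventually.of_forall fun _ => hK) (key hf rfl) (key hg (by rw [h0, h1]))
    (by rw [h0, h1])
  filter_upwards [this] with t ht
  exact ⟨congrArg Prod.fst ht, congrArg Prod.snd ht⟩

lemma IsProfileSolution.comp_add_const {C₁ τ : ℝ} {g g' : ℝ → ℝ} {J : Set ℝ}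
    (h : IsProfileSolution C₁ g g' J) :
    IsProfileSolution C₁ (fun t => g (t + τ)) (fun t => g' (t + τ)) {t | t + τ ∈ J} :=
  fun t ht => ⟨(h _ ht).1.comp_add_const t τ, (h _ ht).2.comp_add_const t τ⟩

lemma IsProfileSolution.mono {C₁ : ℝ} {g g' : ℝ → ℝ} {J I : Set ℝ}
    (h : IsProfileSolution C₁ g g' J) (hI : I ⊆ J) : IsProfileSolution C₁ g g' I :=
  fun t ht => h t (hI ht)

/-- The first integral of the profile equation. -/
lemma IsProfileSolution.exists_energy {C₁ : ℝ} {g g' : ℝ → ℝ} {J : Set ℝ}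
    (h : IsProfileSolution C₁ g g' J) (hJ : IsOpen J) (hJc : IsPreconnected J) :
    ∃ C₂, ∀ t ∈ J, g' t ^ 2 = -(2 / 3) * cubic C₁ C₂ (g t) := by
  have hd (t : ℝ) (ht : t ∈ J) :
      HasDerivAt (fun t => -(3 / 2) * g' t ^ 2 - cubic C₁ 0 (g t)) 0 t := by
    have h1 := (h t ht).1
    have h2 := (h t ht).2
    have := ((h2.fun_pow 2).const_mul (-(3 / 2) : ℝ)).fun_sub
      ((((h1.fun_pow 3).fun_add ((h1.fun_pow 2).const_mul 6)).fun_add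
        (h1.const_mul (6 * C₁))).add_const (0 : ℝ))
    refine this.congr_deriv ?_
    norm_num
    ring
  obtain ⟨c, hc⟩ := hJ.exists_is_const_of_deriv_eq_zero hJc
    (fun t ht => (hd t ht).differentiableAt.differentiableWithinAt) fun t ht => (hd t ht).deriv
  refine ⟨c, fun t ht => ?_⟩
  have := hc t ht
  unfold cubic at *
  linarith

namespace IsModel

variable {C₁ C₂ : ℝ} {S : Set ℝ} {f f' : ℝ → ℝ}

lemma odd_deriv (h : IsModel C₁ C₂ S f f') {t : ℝ} (ht : t ∉ S) : f' (-t) = -f' t := by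
  have h1 : HasDerivAt (fun x => f (-x)) (-f' (-t)) t := by
    have := (h.isSolution (-t) (h.neg_notMem t ht)).1.scomp t (hasDerivAt_neg t)
    simpa [Function.comp_def] using this
  have h2 : HasDerivAt (fun x => f (-x)) (f' t) t :=
    (h.isSolution t ht).1.congr_of_eventuallyEq
      (Filter.eventually_of_mem (h.isClosed.isOpen_compl.mem_nhds ht) h.even)
  linarith [h1.unique h2]

/-- A solution with the energy of a model that takes a value of the model is a translate of it;
it cannot reach a pole because it stays locally bounded. -/
lemma exists_eq_translate (h : IsModel C₁ C₂ S f f') {g g' : ℝ → ℝ} {J : Set ℝ}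
    (hJ : IsOpen J) (hJc : IsPreconnected J) (hg : IsProfileSolution C₁ g g' J)
    (hE : ∀ t ∈ J, g' t ^ 2 = -(2 / 3) * cubic C₁ C₂ (g t)) {t₀ t₁ : ℝ} (ht₀ : t₀ ∈ J)
    (ht₁ : t₁ ∉ S) (heq : f t₁ = g t₀) :
    ∃ τ, ∀ t ∈ J, t + τ ∉ S ∧ g t = f (t + τ) := by
  obtain ⟨t₂, ht₂, h0, h1⟩ : ∃ t₂ ∉ S, f t₂ = g t₀ ∧ f' t₂ = g' t₀ := by
    have : f' t₁ ^ 2 = g' t₀ ^ 2 := by rw [h.energy t₁ ht₁, hE t₀ ht₀, heq]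
    rcases sq_eq_sq_iff_eq_or_eq_neg.1 this with h' | h'
    · exact ⟨t₁, ht₁, heq, h'⟩
    · exact ⟨-t₁, h.neg_notMem t₁ ht₁, by rw [h.even t₁ ht₁, heq],
        by rw [h.odd_deriv ht₁, h', neg_neg]⟩
  obtain ⟨τ, rfl⟩ : ∃ τ, t₂ = t₀ + τ := ⟨t₂ - t₀, by ring⟩
  have hshift := h.isSolution.comp_add_const (τ := τ)
  have hcont : Continuous fun t : ℝ => t + τ := by fun_prop
  -- the points near which both functions are defined and have the same Cauchy data
  let T : Set ℝ := {t | t ∈ J ∧ t + τ ∉ S ∧ g t = f (t + τ) ∧ g' t = f' (t + τ)}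
  have hnear (t : ℝ) (ht : t ∈ J) (hS : t + τ ∉ S) : J ∩ {t | t + τ ∈ Sᶜ} ∈ nhds t :=
    (hJ.inter (h.isClosed.isOpen_compl.preimage hcont)).mem_nhds ⟨ht, hS⟩
  have hT_open : IsOpen T := by
    refine isOpen_iff_mem_nhds.2 fun t ⟨ht, hS, e0, e1⟩ => ?_
    have := eventually_eq_of_cauchy_data (hnear t ht hS) (hg.mono inter_subset_left)
      (hshift.mono inter_subset_right) e0 e1
    filter_upwards [this, hnear t ht hS] with s hs hs'
    exact ⟨hs'.1, hs'.2, hs.1, hs.2⟩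
  have hT_closed : closure T ∩ J ⊆ T := by
    rintro t ⟨htc, ht⟩
    have : (nhdsWithin t T).NeBot := mem_closure_iff_nhdsWithin_neBot.1 htc
    have hmem : ∀ᶠ s in nhdsWithin t T, s ∈ T := self_mem_nhdsWithin
    have hg0 : Filter.Tendsto g (nhdsWithin t T) (nhds (g t)) :=
      (hg t ht).1.continuousAt.tendsto.mono_left nhdsWithin_le_nhds
    have hg1 : Filter.Tendsto g' (nhdsWithin t T) (nhds (g' t)) :=
      (hg t ht).2.continuousAt.tendsto.mono_left nhdsWithin_le_nhds
    have hadd : Filter.Tendsto (fun s : ℝ => s + τ) (nhdsWithin t T) (nhds (t + τ)) :=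
      hcont.continuousAt.tendsto.mono_left nhdsWithin_le_nhds
    have hS : t + τ ∉ S := by
      intro hS
      have h2 : Filter.Tendsto (fun s : ℝ => s + τ) (nhdsWithin t T) (nhdsWithin (t + τ) Sᶜ) :=
        tendsto_nhdsWithin_iff.2 ⟨hadd, hmem.mono fun s hs => hs.2.1⟩
      have h3 : Filter.Tendsto g (nhdsWithin t T) Filter.atBot :=
        ((h.tendsto_pole _ hS).comp h2).congr' (hmem.mono fun s hs => hs.2.2.1.symm)
      exact not_tendsto_nhds_of_tendsto_atBot h3 _ hg0
    refine ⟨ht, hS, ?_, ?_⟩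
    · exact tendsto_nhds_unique hg0 ((((h.isSolution _ hS).1.continuousAt.tendsto.comp hadd)).congr'
        (hmem.mono fun s hs => hs.2.2.1.symm))
    · exact tendsto_nhds_unique hg1 ((((h.isSolution _ hS).2.continuousAt.tendsto.comp hadd)).congr'
        (hmem.mono fun s hs => hs.2.2.2.symm))
  have hsub := hJc.subset_of_closure_inter_subset hT_open
    ⟨t₀, ht₀, ht₀, ht₂, h0.symm, h1.symm⟩ hT_closed
  exact ⟨τ, fun t ht => ⟨(hsub ht).2.1, (hsub ht).2.2.1⟩⟩

/-- Models of the form `P - Q / w²`, where `w'²` is a cubic polynomial in `w²`. -/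
lemma of_inv_sq {P Q A B E G : ℝ} {w w' : ℝ → ℝ} (hQ : 0 < Q)
    (hw : ∀ t, AnalyticAt ℝ w t) (hd : ∀ t, HasDerivAt w (w' t) t)
    (hd' : ∀ t, HasDerivAt w' (B * w t + 2 * E * w t ^ 3 + 3 * G * w t ^ 5) t)
    (hE : ∀ t, w' t ^ 2 = A + B * w t ^ 2 + E * w t ^ 4 + G * w t ^ 6)
    (hsymm : ∀ t, w (-t) ^ 2 = w t ^ 2)
    (hid : ∀ X, 4 * Q ^ 2 * (A * X ^ 3 + B * X ^ 2 + E * X + G)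
      = -(2 / 3) * cubic C₁ C₂ (P - Q * X))
    (hf : ∀ t, w t ≠ 0 → f t = P - Q / w t ^ 2) :
    IsModel C₁ C₂ {t | w t = 0} f (fun t => 2 * Q * w' t / w t ^ 3) := by
  have hcont : Continuous w := continuous_iff_continuousAt.2 fun t => (hd t).continuousAt
  have hopen : IsOpen {t | w t ≠ 0} := isOpen_ne_fun hcont continuous_const
  have hnear (t : ℝ) (ht : w t ≠ 0) : f =ᶠ[nhds t] fun t => P - Q / w t ^ 2 :=
    Filter.eventually_of_mem (hopen.mem_nhds ht) hf
  have hnot (t : ℝ) (ht : w t ≠ 0) : w (-t) ≠ 0 := by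
    rw [← pow_ne_zero_iff two_ne_zero, hsymm]
    exact pow_ne_zero 2 ht
  refine ⟨isClosed_eq hcont continuous_const, fun s hs => ?_, fun t ht => ?_, fun t ht => ?_,
    fun t ht => ?_, hnot, fun t ht => ?_⟩
  · have h1 : Filter.Tendsto (fun t => w t ^ 2) (nhdsWithin s {t | w t = 0}ᶜ)
        (nhdsWithin 0 (Ioi 0)) := by
      refine tendsto_nhdsWithin_iff.2 ⟨?_, ?_⟩
      · have : Filter.Tendsto (fun t => w t ^ 2) (nhds s) (nhds (w s ^ 2)) :=
          (hcont.pow 2).continuousAt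
        rw [show w s = 0 from hs, zero_pow two_ne_zero] at this
        exact this.mono_left nhdsWithin_le_nhds
      · filter_upwards [self_mem_nhdsWithin] with t ht
        exact sq_pos_of_ne_zero ht
    have h2 : Filter.Tendsto (fun t => P - Q / w t ^ 2) (nhdsWithin s {t | w t = 0}ᶜ)
        Filter.atBot := by
      have h3 := (tendsto_inv_nhdsGT_zero.comp h1).const_mul_atTop hQ
      have h4 := Filter.tendsto_atBot_add_const_left _ P (Filter.tendsto_neg_atTop_atBot.comp h3)
      refine h4.congr fun t => ?_
      simp [div_eq_mul_inv, sub_eq_add_neg]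
    refine h2.congr' ?_
    filter_upwards [self_mem_nhdsWithin] with t ht
    exact (hf t ht).symm
  · refine AnalyticAt.congr ?_ (hnear t ht).symm
    exact analyticAt_const.sub (analyticAt_const.div ((hw t).pow 2) (pow_ne_zero 2 ht))
  · have ht' : w t ≠ 0 := ht
    constructor
    · have := (((hasDerivAt_const t Q).fun_div ((hd t).fun_pow 2) (pow_ne_zero 2 ht')).const_sub P)
      refine (this.congr_of_eventuallyEq (hnear t ht)).congr_deriv ?_
      field_simp
      norm_num
      ring
    · have := ((hd' t).const_mul (2 * Q)).fun_div ((hd t).fun_pow 3) (pow_ne_zero 3 ht')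
      refine this.congr_deriv ?_
      have hE' := hE t
      rw [hf t ht']
      generalize w t = x at *
      generalize w' t = y at *
      obtain ⟨z, hz⟩ : ∃ z, z = 1 / x ^ 2 := ⟨_, rfl⟩
      have e1 : (2 * Q * (B * x + 2 * E * x ^ 3 + 3 * G * x ^ 5) * x ^ 3 -
          2 * Q * y * (((3 : ℕ) : ℝ) * x ^ (3 - 1) * y)) / (x ^ 3) ^ 2
          = 2 * Q * (-3 * A * z ^ 2 - 2 * B * z - E) := by
        rw [hz]
        field_simp
        norm_num
        linear_combination (-3 * x ^ 2) * hE'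
      have e2 : P - Q / x ^ 2 = P - Q * z := by rw [hz]; ring
      rw [e1, e2]
      -- differentiate `hid` at `z` by a difference formula that is exact on cubics
      have i1 := hid (z + 1)
      have i2 := hid (z - 1)
      have i3 := hid (z + 2)
      have i4 := hid (z - 2)
      unfold cubic at i1 i2 i3 i4
      apply mul_left_cancel₀ (mul_ne_zero two_ne_zero hQ.ne')
      linear_combination (-8 / 12) * i1 + (8 / 12) * i2 + (1 / 12) * i3 - (1 / 12) * i4
  · have ht' : w t ≠ 0 := ht
    rw [hf t ht', show P - Q / w t ^ 2 = P - Q * (1 / w t ^ 2) by ring, ← hid, div_pow, mul_pow,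
      hE]
    field_simp
    ring
  · rw [hf t ht, hf (-t) (hnot t ht), hsymm]

/-- Models of the form `P - Q w²`, where `w'²` is a quadratic polynomial in `w²`. -/
lemma of_sq {P Q A B E : ℝ} {w w' : ℝ → ℝ} (hQ : 0 < Q)
    (hw : ∀ t, AnalyticAt ℝ w t) (hd : ∀ t, HasDerivAt w (w' t) t)
    (hd' : ∀ t, HasDerivAt w' (B * w t + 2 * E * w t ^ 3) t)
    (hE : ∀ t, w' t ^ 2 = A + B * w t ^ 2 + E * w t ^ 4)
    (hsymm : ∀ t, w (-t) ^ 2 = w t ^ 2)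
    (hid : ∀ X, 4 * Q ^ 2 * (A * X + B * X ^ 2 + E * X ^ 3)
      = -(2 / 3) * cubic C₁ C₂ (P - Q * X)) :
    IsModel C₁ C₂ ∅ (fun t => P - Q * w t ^ 2) (fun t => -2 * Q * w t * w' t) := by
  refine ⟨isClosed_empty, fun s hs => hs.elim, fun t _ => ?_, fun t _ => ⟨?_, ?_⟩,
    fun t _ => ?_, fun t _ => notMem_empty _, fun t _ => by simp only [hsymm]⟩
  · exact analyticAt_const.sub (analyticAt_const.mul ((hw t).pow 2))
  · refine ((((hd t).fun_pow 2).const_mul Q).const_sub P).congr_deriv ?_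
    norm_num
    ring
  · refine (((hd t).const_mul (-2 * Q)).fun_mul (hd' t)).congr_deriv ?_
    have hE' := hE t
    generalize w t = x at *
    generalize w' t = y at *
    have i1 := hid (x ^ 2 + 1)
    have i2 := hid (x ^ 2 - 1)
    have i3 := hid (x ^ 2 + 2)
    have i4 := hid (x ^ 2 - 2)
    unfold cubic at i1 i2 i3 i4
    apply mul_left_cancel₀ (mul_ne_zero two_ne_zero hQ.ne')
    linear_combination (-8 / 12) * i1 + (8 / 12) * i2 + (1 / 12) * i3 - (1 / 12) * i4
      - 4 * Q ^ 2 * hE'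
  · rw [← hid, mul_pow, hE]
    ring

end IsModel

/-! ### The table profiles are global models -/

section AmplitudeFlow

variable {k : ℝ} (ν : ℝ)

lemma hasDerivAt_jacobiAm_mul (hk : k ^ 2 < 1) (t : ℝ) :
    HasDerivAt (fun t => jacobiAm (ν * t) k) (ν * deltaAmp k (jacobiAm (ν * t) k)) t := by
  have := (hasDerivAt_jacobiAm hk (ν * t)).comp t ((hasDerivAt_id t).const_mul ν)
  simpa [Function.comp_def, mul_comm] using this

/-- The amplitude solves the pendulum equation. -/
lemma hasDerivAt_deltaAmp_jacobiAm_mul (hk : k ^ 2 < 1) (t : ℝ) :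
    HasDerivAt (fun t => ν * deltaAmp k (jacobiAm (ν * t) k))
      (-ν ^ 2 * k ^ 2 * sin (jacobiAm (ν * t) k) * cos (jacobiAm (ν * t) k)) t := by
  have := ((hasDerivAt_deltaAmp hk (jacobiAm (ν * t) k)).comp t
    (hasDerivAt_jacobiAm_mul ν hk t)).const_mul ν
  refine this.congr_deriv ?_
  have := (deltaAmp_pos hk (jacobiAm (ν * t) k)).ne'
  field_simp

lemma analyticAt_jacobiAm_mul (hk : k ^ 2 < 1) (t : ℝ) :
    AnalyticAt ℝ (fun t => jacobiAm (ν * t) k) t :=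
  (analyticAt_jacobiAm hk (ν * t)).comp (f := fun t => ν * t) (by fun_prop)

variable {ν}

lemma exists_jacobiAm_mul_eq (hk : k ^ 2 < 1) (hν : ν ≠ 0) (φ : ℝ) :
    ∃ t, jacobiAm (ν * t) k = φ :=
  ⟨ellipticF φ k / ν, by rw [mul_div_cancel₀ _ hν, jacobiAm_ellipticF hk]⟩

end AmplitudeFlow

/-- `f` is a global model all of whose translates are table profiles. -/
def IsTableModel (C₁ C₂ : ℝ) (S : Set ℝ) (f : ℝ → ℝ) : Prop :=
  (∃ f', IsModel C₁ C₂ S f f') ∧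
    ∀ τ, ∃ F, IsTableProfile C₁ C₂ F ∧ ∀ t, F t = f (t + τ)

/-- Values below `P - Q` are taken by `P - Q / w²` if `w` takes all values in `(0, 1)`. -/
lemma exists_sub_div_sq_eq {P Q h : ℝ} {w : ℝ → ℝ} (hQ : 0 < Q) (hh : h < P - Q)
    (hw : ∀ y ∈ Ioo (0 : ℝ) 1, ∃ t, w t = y) : ∃ t, w t ≠ 0 ∧ P - Q / w t ^ 2 = h := by
  have hPh : 0 < P - h := by linarith
  have hq : 0 < Q / (P - h) := by positivity
  obtain ⟨t, ht⟩ := hw √(Q / (P - h)) ⟨sqrt_pos.2 hq, by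
    rw [sqrt_lt' one_pos, one_pow, div_lt_one hPh]; linarith⟩
  refine ⟨t, by rw [ht]; exact (sqrt_pos.2 hq).ne', ?_⟩
  rw [ht, sq_sqrt hq.le]
  field_simp
  ring

/-- Values between `P - Q` and `P` are taken by `P - Q w²` if `w` takes all values in `(0, 1)`. -/
lemma exists_sub_mul_sq_eq {P Q h : ℝ} {w : ℝ → ℝ} (hQ : 0 < Q) (hh : P - Q < h) (hP : h < P)
    (hw : ∀ y ∈ Ioo (0 : ℝ) 1, ∃ t, w t = y) : ∃ t, P - Q * w t ^ 2 = h := by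
  have hq : 0 < (P - h) / Q := div_pos (by linarith) hQ
  obtain ⟨t, ht⟩ := hw √((P - h) / Q) ⟨sqrt_pos.2 hq, by
    rw [sqrt_lt' one_pos, one_pow, div_lt_one hQ]; linarith⟩
  refine ⟨t, ?_⟩
  rw [ht, sq_sqrt hq.le]
  field_simp
  ring

lemma cubic_eq_of_complex_roots {C₁ C₂ α m n : ℝ} (h1 : -2 * m - α = 6)
    (h2 : m ^ 2 + n ^ 2 + 2 * α * m = 6 * C₁) (h3 : -α * (m ^ 2 + n ^ 2) = C₂) (h : ℝ) :
    cubic C₁ C₂ h = (h - α) * ((h - m) ^ 2 + n ^ 2) := by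
  unfold cubic
  linear_combination -h ^ 2 * h1 - h * h2 - h3

lemma cubic_eq_of_roots {C₁ C₂ a b c : ℝ} (hab : a < b) (hbc : b < c)
    (ha : cubic C₁ C₂ a = 0) (hb : cubic C₁ C₂ b = 0) (hc : cubic C₁ C₂ c = 0) (h : ℝ) :
    cubic C₁ C₂ h = (h - a) * (h - b) * (h - c) := by
  unfold cubic at *
  have e1 : a ^ 2 + a * b + b ^ 2 + 6 * (a + b) + 6 * C₁ = 0 := by
    apply mul_left_cancel₀ (sub_ne_zero.2 hab.ne)
    linear_combination ha - hb
  have e2 : b ^ 2 + b * c + c ^ 2 + 6 * (b + c) + 6 * C₁ = 0 := by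
    apply mul_left_cancel₀ (sub_ne_zero.2 hbc.ne)
    linear_combination hb - hc
  have e3 : a + b + c + 6 = 0 := by
    apply mul_left_cancel₀ (sub_ne_zero.2 (hab.trans hbc).ne)
    linear_combination e1 - e2
  obtain rfl : c = -6 - a - b := by linarith
  linear_combination (h - a) * e1 + ha

/-- Region `I`: one simple real root and no bounded solution. -/
lemma exists_tableModel_regionI {C₁ C₂ α m n : ℝ} (hr : (C₁, C₂) ∈ regionI) (hn : n ≠ 0)
    (h1 : -2 * m - α = 6) (h2 : m ^ 2 + n ^ 2 + 2 * α * m = 6 * C₁)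
    (h3 : -α * (m ^ 2 + n ^ 2) = C₂) :
    ∃ S f, IsTableModel C₁ C₂ S f ∧ S.Nonempty ∧ ∀ h, cubic C₁ C₂ h < 0 → ∃ t ∉ S, f t = h := by
  obtain ⟨β, hβ⟩ : ∃ β, β = √((m - α) ^ 2 + n ^ 2) := ⟨_, rfl⟩
  have hn2 : 0 < n ^ 2 := by positivity
  have hβ2 : β ^ 2 = (m - α) ^ 2 + n ^ 2 := by rw [hβ, sq_sqrt (by positivity)]
  have hβ0 : 0 < β := by rw [hβ]; exact sqrt_pos.2 (by positivity)
  have hlt : |m - α| < β := abs_lt_of_sq_lt_sq (by linarith) hβ0.le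
  obtain ⟨hl, hu⟩ := abs_lt.1 hlt
  obtain ⟨k, hk⟩ : ∃ k, k = √((β - m + α) / (2 * β)) := ⟨_, rfl⟩
  have hk2 : k ^ 2 = (β - m + α) / (2 * β) := by
    rw [hk, sq_sqrt (div_nonneg (by linarith) (by linarith))]
  have hk1 : k ^ 2 < 1 := by
    rw [hk2, div_lt_one (by linarith)]
    linarith
  obtain ⟨ν, hν⟩ : ∃ ν, ν = √(6 * β) / 3 := ⟨_, rfl⟩
  have hν0 : 0 < ν := by rw [hν]; positivity
  have hν2 : ν ^ 2 = 2 * β / 3 := by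
    rw [hν, div_pow, sq_sqrt (by positivity)]
    ring
  let w : ℝ → ℝ := fun t => sin (1 / 2 * jacobiAm (ν * t) k)
  have hsurj (y : ℝ) (hy : y ∈ Icc (-1 : ℝ) 1) : ∃ t, w t = y := by
    obtain ⟨t, ht⟩ := exists_jacobiAm_mul_eq hk1 hν0.ne' (2 * arcsin y)
    refine ⟨t, ?_⟩
    simp only [w, ht]
    rw [← mul_assoc]
    norm_num
    exact sin_arcsin hy.1 hy.2
  have hform (t : ℝ) (ht : w t ≠ 0) : profile1 α β m 0 t = α + β - β / w t ^ 2 := by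
    simp only [profile1, ← hk, ← hν, mul_zero, add_zero, cot_eq_cos_div_sin]
    have hc := cos_sq' (1 / 2 * jacobiAm (ν * t) k)
    simp only [w] at ht ⊢
    rw [div_pow, hc]
    generalize sin (1 / 2 * jacobiAm (ν * t) k) = x at ht ⊢
    field_simp
    ring
  have hA (t : ℝ) := (hasDerivAt_jacobiAm_mul ν hk1 t).const_mul (1 / 2)
  have hA' (t : ℝ) := hasDerivAt_deltaAmp_jacobiAm_mul ν hk1 t
  have hmodel := IsModel.of_inv_sq (C₁ := C₁) (C₂ := C₂) (P := α + β) (Q := β)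
    (A := ν ^ 2 / 4) (B := -(ν ^ 2 / 4) * (1 + 4 * k ^ 2)) (E := 2 * ν ^ 2 * k ^ 2)
    (G := -ν ^ 2 * k ^ 2) (w := w) (f := profile1 α β m 0) hβ0
    (fun t => analyticAt_sin.comp (analyticAt_const.mul (analyticAt_jacobiAm_mul ν hk1 t)))
    (fun t => (hA t).sin)
    (fun t => by
      refine ((hA t).cos.fun_mul ((hA' t).const_mul (1 / 2))).congr_deriv ?_
      have hΔ := sq_deltaAmp hk1 (jacobiAm (ν * t) k)
      have hs := sin_two_mul (1 / 2 * jacobiAm (ν * t) k)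
      have hc := cos_two_mul' (1 / 2 * jacobiAm (ν * t) k)
      have hcs := cos_sq' (1 / 2 * jacobiAm (ν * t) k)
      rw [show 2 * (1 / 2 * jacobiAm (ν * t) k) = jacobiAm (ν * t) k by ring] at hs hc
      simp only [w]
      rw [hs] at hΔ
      rw [hc, hs]
      generalize sin (1 / 2 * jacobiAm (ν * t) k) = s at *
      generalize cos (1 / 2 * jacobiAm (ν * t) k) = c at *
      generalize deltaAmp k (jacobiAm (ν * t) k) = Δ at *
      linear_combination (-s * ν ^ 2 / 4) * hΔ
        + (s ^ 3 * ν ^ 2 * k ^ 2 - ν ^ 2 * k ^ 2 * s * (c ^ 2 + 1 - 2 * s ^ 2)) * hcs)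
    (fun t => by
      have hΔ := sq_deltaAmp hk1 (jacobiAm (ν * t) k)
      have hs := sin_two_mul (1 / 2 * jacobiAm (ν * t) k)
      have hcs := cos_sq' (1 / 2 * jacobiAm (ν * t) k)
      rw [show 2 * (1 / 2 * jacobiAm (ν * t) k) = jacobiAm (ν * t) k by ring] at hs
      simp only [w]
      rw [hs] at hΔ
      generalize sin (1 / 2 * jacobiAm (ν * t) k) = s at *
      generalize cos (1 / 2 * jacobiAm (ν * t) k) = c at *
      generalize deltaAmp k (jacobiAm (ν * t) k) = Δ at *
      linear_combination (c ^ 2 * ν ^ 2 / 4) * hΔ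
        + (ν ^ 2 / 4 * (1 - 4 * k ^ 2 * s ^ 2 * (c ^ 2 + 1 - s ^ 2))) * hcs)
    (fun t => by simp only [w, mul_neg, jacobiAm_neg hk1, sin_neg, neg_sq])
    (fun X => by
      rw [cubic_eq_of_complex_roots h1 h2 h3, hν2, hk2]
      rw [show n ^ 2 = β ^ 2 - (m - α) ^ 2 by linarith]
      field_simp
      ring)
    hform
  refine ⟨_, _, ⟨⟨_, hmodel⟩, fun τ => ⟨profile1 α β m (ν / √β * τ),
    .regI hr α β m n _ hn h1 h2 h3 hβ, fun t => ?_⟩⟩, ?_, fun h hh => ?_⟩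
  · have hsβ : √β ≠ 0 := (sqrt_pos.2 hβ0).ne'
    simp only [profile1, ← hν]
    rw [show ν * t + √β * (ν / √β * τ) = ν * (t + τ) + √β * 0 by field_simp; ring]
  · exact hsurj 0 (by norm_num)
  · rw [cubic_eq_of_complex_roots h1 h2 h3] at hh
    have hlt' : h < α := by
      by_contra! hge
      exact absurd hh (mul_nonneg (sub_nonneg.2 hge) (by positivity)).not_gt
    obtain ⟨t, ht, e⟩ := exists_sub_div_sq_eq (w := w) hβ0 (show h < α + β - β by linarith)
      fun y hy => hsurj y ⟨by linarith [hy.1], hy.2.le⟩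
    exact ⟨t, ht, (hform t ht).trans e⟩

/-- The triple root at `P₀`. -/
lemma exists_tableModel_pointP0 :
    ∃ S f, IsTableModel 2 8 S f ∧ S.Nonempty ∧ ∀ h, cubic 2 8 h < 0 → ∃ t ∉ S, f t = h := by
  have hcub (h : ℝ) : cubic 2 8 h = (h + 2) ^ 3 := by unfold cubic; ring
  have hmodel := IsModel.of_inv_sq (C₁ := 2) (C₂ := 8) (P := -2) (Q := 6)
    (A := 1) (B := 0) (E := 0) (G := 0) (w := fun t => t) (w' := fun _ => 1) (f := profile2 0)
    (by norm_num) (fun t => analyticAt_id) (fun t => hasDerivAt_id t)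
    (fun t => by simpa using hasDerivAt_const t (1 : ℝ)) (fun t => by norm_num)
    (fun t => by ring) (fun X => by rw [hcub]; ring) (fun t ht => by simp [profile2])
  refine ⟨_, _, ⟨⟨_, hmodel⟩, fun τ => ⟨profile2 τ, .ptP0 rfl _, fun t => by simp [profile2]⟩⟩,
    ⟨0, rfl⟩, fun h hh => ?_⟩
  rw [hcub] at hh
  have hlt : 0 < -2 - h := by
    have := (Odd.pow_neg_iff (by decide : Odd 3)).1 hh
    linarith
  have hq : 0 < 6 / (-2 - h) := by positivity
  refine ⟨√(6 / (-2 - h)), (sqrt_pos.2 hq).ne', ?_⟩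
  rw [profile2, add_zero, sq_sqrt hq.le]
  field_simp
  ring

/-- The modulus `k² = (c - b) / (c - a)` belonging to three distinct real roots. -/
lemma modulus_sq {a b c : ℝ} (hab : a < b) (hbc : b < c) :
    √((c - b) / (c - a)) ^ 2 = (c - b) / (c - a) ∧ √((c - b) / (c - a)) ^ 2 < 1 := by
  have h : √((c - b) / (c - a)) ^ 2 = (c - b) / (c - a) :=
    sq_sqrt (div_nonneg (by linarith) (by linarith))
  refine ⟨h, ?_⟩
  rw [h, div_lt_one (by linarith)]
  linarith

lemma frequency_sq {a b c : ℝ} (hab : a < b) (hbc : b < c) :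
    √((c - a) / 6) ^ 2 = (c - a) / 6 ∧ 0 < √((c - a) / 6) :=
  ⟨sq_sqrt (by linarith), sqrt_pos.2 (by linarith)⟩

lemma profile3_translate {a b c : ℝ} (hac : a < c) (τ t : ℝ) :
    profile3 a b c (√((c - a) / 6) / √(c - a) * τ) t = profile3 a b c 0 (t + τ) := by
  have h : √(c - a) ≠ 0 := (sqrt_pos.2 (by linarith)).ne'
  simp only [profile3]
  rw [show √((c - a) / 6) * t + √(c - a) * (√((c - a) / 6) / √(c - a) * τ)
    = √((c - a) / 6) * (t + τ) + √(c - a) * 0 by field_simp; ring]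

lemma profile4_translate {a b c : ℝ} (hac : a < c) (τ t : ℝ) :
    profile4 a b c (√((c - a) / 6) / √(c - a) * τ) t = profile4 a b c 0 (t + τ) := by
  have h : √(c - a) ≠ 0 := (sqrt_pos.2 (by linarith)).ne'
  simp only [profile4]
  rw [show √((c - a) / 6) * t + √(c - a) * (√((c - a) / 6) / √(c - a) * τ)
    = √((c - a) / 6) * (t + τ) + √(c - a) * 0 by field_simp; ring]

/-- The bounded profile of region `II` as a global model without poles. -/
lemma isModel_profile3 {C₁ C₂ a b c : ℝ} (hab : a < b) (hbc : b < c)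
    (ha : cubic C₁ C₂ a = 0) (hb : cubic C₁ C₂ b = 0) (hc : cubic C₁ C₂ c = 0) :
    ∃ f', IsModel C₁ C₂ ∅ (profile3 a b c 0) f' := by
  obtain ⟨hk2, hk1⟩ := modulus_sq hab hbc
  obtain ⟨hν2, hν0⟩ := frequency_sq hab hbc
  have hdef : profile3 a b c 0 = fun t => c - (c - b) *
      sin (jacobiAm (√((c - a) / 6) * t) (√((c - b) / (c - a)))) ^ 2 := by
    funext t
    simp only [profile3, mul_zero, add_zero]
  rw [hdef]
  generalize √((c - b) / (c - a)) = k at *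
  generalize √((c - a) / 6) = ν at *
  have hA (t : ℝ) := hasDerivAt_jacobiAm_mul ν hk1 t
  have hA' (t : ℝ) := hasDerivAt_deltaAmp_jacobiAm_mul ν hk1 t
  refine ⟨_, IsModel.of_sq (A := ν ^ 2) (B := -ν ^ 2 * (1 + k ^ 2)) (E := ν ^ 2 * k ^ 2)
    (w := fun t => sin (jacobiAm (ν * t) k)) (by linarith : 0 < c - b)
    (fun t => analyticAt_sin.comp (analyticAt_jacobiAm_mul ν hk1 t)) (fun t => (hA t).sin)
    (fun t => ?_) (fun t => ?_)
    (fun t => by simp only [mul_neg, jacobiAm_neg hk1, sin_neg, neg_sq]) (fun X => ?_)⟩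
  · refine ((hA t).cos.fun_mul (hA' t)).congr_deriv ?_
    have hΔ := sq_deltaAmp hk1 (jacobiAm (ν * t) k)
    have hcs := cos_sq' (jacobiAm (ν * t) k)
    generalize sin (jacobiAm (ν * t) k) = s at *
    generalize cos (jacobiAm (ν * t) k) = x at *
    generalize deltaAmp k (jacobiAm (ν * t) k) = Δ at *
    linear_combination (-s * ν ^ 2) * hΔ - (ν ^ 2 * k ^ 2 * s) * hcs
  · have hΔ := sq_deltaAmp hk1 (jacobiAm (ν * t) k)
    have hcs := cos_sq' (jacobiAm (ν * t) k)
    generalize sin (jacobiAm (ν * t) k) = s at *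
    generalize cos (jacobiAm (ν * t) k) = x at *
    generalize deltaAmp k (jacobiAm (ν * t) k) = Δ at *
    linear_combination (x ^ 2 * ν ^ 2) * hΔ + (ν ^ 2 * (1 - k ^ 2 * s ^ 2)) * hcs
  · rw [cubic_eq_of_roots hab hbc ha hb hc, hν2, hk2]
    have : c - a ≠ 0 := by linarith
    field_simp
    ring

lemma exists_profile3_eq {a b c h : ℝ} (hab : a < b) (hbc : b < c) (hb : b < h) (hc : h < c) :
    ∃ t, profile3 a b c 0 t = h := by
  obtain ⟨_, hk1⟩ := modulus_sq hab hbc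
  obtain ⟨_, hν0⟩ := frequency_sq hab hbc
  simp only [profile3, mul_zero, add_zero]
  refine exists_sub_mul_sq_eq (w := fun t =>
    sin (jacobiAm (√((c - a) / 6) * t) (√((c - b) / (c - a))))) (by linarith) (by linarith) hc
    fun y hy => ?_
  obtain ⟨t, ht⟩ := exists_jacobiAm_mul_eq hk1 hν0.ne' (arcsin y)
  exact ⟨t, by rw [ht, sin_arcsin (by linarith [hy.1]) hy.2.le]⟩

/-- Region `II`: the unbounded solutions. -/
lemma exists_tableModel_regionII_unbounded {C₁ C₂ a b c : ℝ} (hr : (C₁, C₂) ∈ regionII)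
    (hab : a < b) (hbc : b < c)
    (ha : cubic C₁ C₂ a = 0) (hb : cubic C₁ C₂ b = 0) (hc : cubic C₁ C₂ c = 0) :
    ∃ S f, IsTableModel C₁ C₂ S f ∧ S.Nonempty ∧ ∀ h < a, ∃ t ∉ S, f t = h := by
  have hmodel : ∃ S, (∃ f', IsModel C₁ C₂ S (profile4 a b c 0) f') ∧ S.Nonempty ∧
      ∀ h < a, ∃ t ∉ S, profile4 a b c 0 t = h := by
    obtain ⟨hk2, hk1⟩ := modulus_sq hab hbc
    obtain ⟨hν2, hν0⟩ := frequency_sq hab hbc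
    have hdef : profile4 a b c 0 = fun t => a - (b - a) *
        tan (jacobiAm (√((c - a) / 6) * t) (√((c - b) / (c - a)))) ^ 2 := by
      funext t
      simp only [profile4, mul_zero, add_zero]
    rw [hdef]
    generalize √((c - b) / (c - a)) = k at *
    generalize √((c - a) / 6) = ν at *
    let w : ℝ → ℝ := fun t => cos (jacobiAm (ν * t) k)
    have hsurj (y : ℝ) (hy : y ∈ Icc (-1 : ℝ) 1) : ∃ t, w t = y := by
      obtain ⟨t, ht⟩ := exists_jacobiAm_mul_eq hk1 hν0.ne' (arccos y)
      exact ⟨t, by simp only [w]; rw [ht, cos_arccos hy.1 hy.2]⟩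
    have hform (t : ℝ) (ht : w t ≠ 0) : a - (b - a) * tan (jacobiAm (ν * t) k) ^ 2
        = b - (b - a) / w t ^ 2 := by
      have hs := sin_sq (jacobiAm (ν * t) k)
      simp only [w] at ht ⊢
      rw [tan_eq_sin_div_cos, div_pow, hs]
      generalize cos (jacobiAm (ν * t) k) = x at ht ⊢
      field_simp
      ring
    have hA (t : ℝ) := hasDerivAt_jacobiAm_mul ν hk1 t
    have hA' (t : ℝ) := hasDerivAt_deltaAmp_jacobiAm_mul ν hk1 t
    refine ⟨_, ⟨_, IsModel.of_inv_sq (A := ν ^ 2 * (1 - k ^ 2)) (B := ν ^ 2 * (2 * k ^ 2 - 1))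
      (E := -ν ^ 2 * k ^ 2) (G := 0) (w := w) (by linarith : 0 < b - a)
      (fun t => analyticAt_cos.comp (analyticAt_jacobiAm_mul ν hk1 t)) (fun t => (hA t).cos)
      (fun t => ?_) (fun t => ?_)
      (fun t => by simp only [w, mul_neg, jacobiAm_neg hk1, cos_neg]) (fun X => ?_) hform⟩,
      hsurj 0 (by norm_num), fun h hh => ?_⟩
    · refine ((hA t).sin.fun_neg.fun_mul (hA' t)).congr_deriv ?_
      have hΔ := sq_deltaAmp hk1 (jacobiAm (ν * t) k)
      have hcs := cos_sq' (jacobiAm (ν * t) k)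
      simp only [w]
      generalize sin (jacobiAm (ν * t) k) = s at *
      generalize cos (jacobiAm (ν * t) k) = x at *
      generalize deltaAmp k (jacobiAm (ν * t) k) = Δ at *
      linear_combination (-x * ν ^ 2) * hΔ + (2 * ν ^ 2 * k ^ 2 * x) * hcs
    · have hΔ := sq_deltaAmp hk1 (jacobiAm (ν * t) k)
      have hcs := sin_sq (jacobiAm (ν * t) k)
      simp only [w]
      generalize sin (jacobiAm (ν * t) k) = s at *
      generalize cos (jacobiAm (ν * t) k) = x at *
      generalize deltaAmp k (jacobiAm (ν * t) k) = Δ at *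
      linear_combination (s ^ 2 * ν ^ 2) * hΔ
        + (ν ^ 2 * (1 - k ^ 2 * (s ^ 2 + 1 - x ^ 2))) * hcs
    · rw [cubic_eq_of_roots hab hbc ha hb hc, hν2, hk2]
      have : c - a ≠ 0 := by linarith
      field_simp
      ring
    · obtain ⟨t, ht, e⟩ := exists_sub_div_sq_eq (w := w) (by linarith : 0 < b - a)
        (show h < b - (b - a) by linarith) fun y hy => hsurj y ⟨by linarith [hy.1], hy.2.le⟩
      exact ⟨t, ht, (hform t ht).trans e⟩
  obtain ⟨S, hm, hS, hsurj⟩ := hmodel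
  exact ⟨S, _, ⟨hm, fun τ => ⟨_, .regIIunbounded hr a b c _ hab hbc ha hb hc,
    fun t => profile4_translate (hab.trans hbc) τ t⟩⟩, hS, hsurj⟩

/-- The curve `Γ₊`: the double root lies above the simple root. -/
lemma exists_tableModel_gammaPlus {C₁ C₂ s : ℝ} (hr : (C₁, C₂) ∈ gammaPlus)
    (hs : s = √(2 * (2 - C₁))) (hcub : ∀ h, cubic C₁ C₂ h = (h + 2 - s) ^ 2 * (h + 2 + 2 * s)) :
    ∃ S f, IsTableModel C₁ C₂ S f ∧ S.Nonempty ∧ ∀ h, cubic C₁ C₂ h < 0 → ∃ t ∉ S, f t = h := by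
  have hC : C₁ < 2 := hr.1
  have hs0 : 0 < s := by rw [hs]; exact sqrt_pos.2 (by linarith)
  have hs2 : s ^ 2 = 2 * (2 - C₁) := by rw [hs, sq_sqrt (by linarith)]
  obtain ⟨ν, hν⟩ : ∃ ν, ν = ((2 - C₁) / 2) ^ (1 / 4 : ℝ) := ⟨_, rfl⟩
  have hν0 : 0 < ν := by rw [hν]; exact rpow_pos_of_pos (by linarith) _
  have hν2 : ν ^ 2 = s / 2 := by
    have h4 : (ν ^ 2) ^ 2 = (s / 2) ^ 2 := by
      rw [← pow_mul, hν, ← rpow_natCast, ← rpow_mul (by linarith)]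
      norm_num
      linarith
    exact (sq_eq_sq₀ (by positivity) (by positivity)).1 h4
  let w : ℝ → ℝ := fun t => cos (ν * t)
  have hsurj (y : ℝ) (hy : y ∈ Icc (-1 : ℝ) 1) : ∃ t, w t = y :=
    ⟨arccos y / ν, by simp only [w]; rw [mul_div_cancel₀ _ hν0.ne', cos_arccos hy.1 hy.2]⟩
  have hform (t : ℝ) (ht : w t ≠ 0) : profile5 C₁ 0 t = -2 + s - 3 * s / w t ^ 2 := by
    simp only [profile5, ← hs, ← hν, add_zero]
    have h := sin_sq (ν * t)
    simp only [w] at ht ⊢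
    rw [tan_eq_sin_div_cos, div_pow, h]
    generalize cos (ν * t) = x at ht ⊢
    field_simp
    ring
  have hlin (t : ℝ) : HasDerivAt (fun t => ν * t) ν t := by
    simpa using (hasDerivAt_id t).const_mul ν
  have hmodel := IsModel.of_inv_sq (C₁ := C₁) (C₂ := C₂) (P := -2 + s) (Q := 3 * s)
    (A := ν ^ 2) (B := -ν ^ 2) (E := 0) (G := 0) (w := w) (f := profile5 C₁ 0) (by linarith)
    (fun t => analyticAt_cos.comp (f := fun t => ν * t) (by fun_prop)) (fun t => (hlin t).cos)
    (fun t => ((hlin t).sin.fun_neg.mul_const ν).congr_deriv (by simp only [w]; ring))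
    (fun t => by
      have h := sin_sq (ν * t)
      simp only [w]
      linear_combination ν ^ 2 * h)
    (fun t => by simp only [w, mul_neg, cos_neg])
    (fun X => by rw [hcub, hν2]; ring) hform
  refine ⟨_, _, ⟨⟨_, hmodel⟩, fun τ => ⟨profile5 C₁ (ν * τ), .gamPlus hr _, fun t => ?_⟩⟩,
    hsurj 0 (by norm_num), fun h hh => ?_⟩
  · simp only [profile5, ← hν]
    rw [show ν * t + ν * τ = ν * (t + τ) + 0 by ring]
  · rw [hcub] at hh
    have hlt : h < -2 + s - 3 * s := by
      by_contra! hge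
      exact absurd hh (mul_nonneg (sq_nonneg _) (by linarith)).not_gt
    obtain ⟨t, ht, e⟩ := exists_sub_div_sq_eq (w := w) (by linarith : 0 < 3 * s) hlt
      fun y hy => hsurj y ⟨by linarith [hy.1], hy.2.le⟩
    exact ⟨t, ht, (hform t ht).trans e⟩

lemma hasDerivAt_tanh_mul (ν t : ℝ) :
    HasDerivAt (fun t => tanh (ν * t)) (ν * (1 - tanh (ν * t) ^ 2)) t := by
  have hlin : HasDerivAt (fun t => ν * t) ν t := by
    simpa using (hasDerivAt_id t).const_mul ν
  have hc := (cosh_pos (ν * t)).ne'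
  have h := hlin.sinh.fun_div hlin.cosh hc
  simp only [tanh_eq_sinh_div_cosh]
  refine h.congr_deriv ?_
  field_simp

lemma analyticAt_tanh_mul (ν t : ℝ) : AnalyticAt ℝ (fun t => tanh (ν * t)) t := by
  simp only [tanh_eq_sinh_div_cosh]
  exact AnalyticAt.div (analyticAt_sinh.comp (f := fun t => ν * t) (by fun_prop))
    (analyticAt_cosh.comp (f := fun t => ν * t) (by fun_prop)) (cosh_pos _).ne'

/-- The curve `Γ₋`: the double root separates a homoclinic solution from unbounded ones. The
homoclinic solution takes its maximum only once. -/
lemma exists_tableModel_gammaMinus {C₁ C₂ s : ℝ} (hr : (C₁, C₂) ∈ gammaMinus)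
    (hs : s = √(2 * (2 - C₁))) (hcub : ∀ h, cubic C₁ C₂ h = (h + 2 + s) ^ 2 * (h + 2 - 2 * s))
    {h : ℝ} (hh : cubic C₁ C₂ h < 0) :
    ∃ S f, IsTableModel C₁ C₂ S f ∧ (∃ t ∉ S, f t = h) ∧
      (S.Nonempty ∨ ∀ t, f t = f 0 → t = 0) := by
  have hC : C₁ < 2 := hr.1
  have hs0 : 0 < s := by rw [hs]; exact sqrt_pos.2 (by linarith)
  have hs2 : s ^ 2 = 2 * (2 - C₁) := by rw [hs, sq_sqrt (by linarith)]
  obtain ⟨x, hx⟩ : ∃ x, x = (2 - C₁) ^ (1 / 4 : ℝ) := ⟨_, rfl⟩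
  obtain ⟨y, hy⟩ : ∃ y, y = (8 : ℝ) ^ (1 / 4 : ℝ) := ⟨_, rfl⟩
  have hx0 : 0 < x := by rw [hx]; exact rpow_pos_of_pos (by linarith) _
  have hy0 : 0 < y := by rw [hy]; positivity
  have hx4 : x ^ 4 = 2 - C₁ := by
    rw [hx, ← rpow_natCast, ← rpow_mul (by linarith)]
    norm_num
  have hy4 : y ^ 4 = 8 := by
    rw [hy, ← rpow_natCast, ← rpow_mul (by norm_num)]
    norm_num
  obtain ⟨ν, hν⟩ : ∃ ν, ν = x / 2 * y := ⟨_, rfl⟩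
  have hν0 : 0 < ν := by rw [hν]; positivity
  have hν2 : ν ^ 2 = s / 2 := by
    have h4 : (ν ^ 2) ^ 2 = (s / 2) ^ 2 := by
      rw [hν]
      linear_combination (y ^ 4 / 16) * hx4 + ((2 - C₁) / 16) * hy4 - (1 / 4) * hs2
    exact (sq_eq_sq₀ (by positivity) (by positivity)).1 h4
  let w : ℝ → ℝ := fun t => tanh (ν * t)
  have hw (t : ℝ) : HasDerivAt w (ν * (1 - w t ^ 2)) t := hasDerivAt_tanh_mul ν t
  have hw' (t : ℝ) : HasDerivAt (fun t => ν * (1 - w t ^ 2))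
      ((-2 * ν ^ 2) * w t + 2 * ν ^ 2 * w t ^ 3) t := by
    refine ((((hw t).fun_pow 2).const_sub 1).const_mul ν).congr_deriv ?_
    norm_num
    ring
  have hsurj (y : ℝ) (hy : y ∈ Ioo (-1 : ℝ) 1) : ∃ t, w t = y :=
    ⟨artanh y / ν, by simp only [w]; rw [mul_div_cancel₀ _ hν0.ne', tanh_artanh hy]⟩
  have hinj (t : ℝ) (ht : w t = 0) : t = 0 := by
    simp only [w, tanh_eq_sinh_div_cosh, div_eq_zero_iff, (cosh_pos _).ne', or_false,
      sinh_eq_zero, mul_eq_zero, hν0.ne', false_or] at ht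
    exact ht
  have hw0 : w 0 = 0 := by simp [w]
  have harg (τ t : ℝ) : x / 2 * (y * t + y * τ) = ν * (t + τ) := by rw [hν]; ring
  have hne : h + 2 + s ≠ 0 := by
    rintro h0
    rw [hcub, h0] at hh
    simp at hh
  have hup : h < -2 + 2 * s := by
    by_contra! hge
    rw [hcub] at hh
    exact absurd hh (mul_nonneg (sq_nonneg _) (by linarith)).not_gt
  rcases lt_or_gt_of_ne hne with hlt | hgt
  · have hform (t : ℝ) : profile7 C₁ 0 t = -2 + 2 * s - 3 * s / w t ^ 2 := by
      simp only [profile7, ← hs, ← hx, ← hy, w, hν, add_zero, mul_assoc]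
      ring
    have hmodel := IsModel.of_inv_sq (C₁ := C₁) (C₂ := C₂) (P := -2 + 2 * s) (Q := 3 * s)
      (A := ν ^ 2) (B := -2 * ν ^ 2) (E := ν ^ 2) (G := 0) (w := w) (f := profile7 C₁ 0)
      (by linarith) (analyticAt_tanh_mul ν) hw (fun t => (hw' t).congr_deriv (by ring))
      (fun t => by ring) (fun t => by simp only [w, mul_neg, tanh_neg, neg_sq])
      (fun X => by rw [hcub, hν2]; ring) fun t _ => hform t
    obtain ⟨t, ht, e⟩ := exists_sub_div_sq_eq (w := w) (by linarith : 0 < 3 * s)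
      (by linarith : h < -2 + 2 * s - 3 * s) fun y hy => hsurj y ⟨by linarith [hy.1], hy.2⟩
    refine ⟨_, _, ⟨⟨_, hmodel⟩, fun τ => ⟨profile7 C₁ (y * τ), .gamMinusUnbounded hr _,
      fun t => ?_⟩⟩, ⟨t, ht, (hform t).trans e⟩, .inl ⟨0, hw0⟩⟩
    have h2 := harg 0 (t + τ)
    simp only [mul_zero, add_zero] at h2
    simp only [profile7, ← hx, ← hy, harg, add_zero, h2]
  · have hform : profile6 C₁ 0 = fun t => -2 + 2 * s - 3 * s * w t ^ 2 := by
      funext t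
      simp only [profile6, ← hs, ← hx, ← hy, w, hν, add_zero, mul_assoc]
    have hmodel := IsModel.of_sq (C₁ := C₁) (C₂ := C₂) (P := -2 + 2 * s) (Q := 3 * s)
      (A := ν ^ 2) (B := -2 * ν ^ 2) (E := ν ^ 2) (w := w)
      (by linarith) (analyticAt_tanh_mul ν) hw hw'
      (fun t => by ring) (fun t => by simp only [w, mul_neg, tanh_neg, neg_sq])
      (fun X => by rw [hcub, hν2]; ring)
    rw [← hform] at hmodel
    obtain ⟨t, e⟩ := exists_sub_mul_sq_eq (w := w) (by linarith : 0 < 3 * s)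
      (by linarith : -2 + 2 * s - 3 * s < h) hup fun y hy => hsurj y ⟨by linarith [hy.1], hy.2⟩
    refine ⟨_, _, ⟨⟨_, hmodel⟩, fun τ => ⟨profile6 C₁ (y * τ), .gamMinusBounded hr _,
      fun t => ?_⟩⟩, ⟨t, notMem_empty _, (congrFun hform t).trans e⟩, .inr fun t ht => hinj t ?_⟩
    · have h2 := harg 0 (t + τ)
      simp only [mul_zero, add_zero] at h2
      simp only [profile6, ← hx, ← hy, harg, add_zero, h2]
    · rw [hform] at ht
      simp only [hw0] at ht
      have : 3 * s * w t ^ 2 = 0 := by linarith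
      simpa [hs0.ne'] using this

/-! ### Classification of the solutions of the profile equation -/

lemma continuous_cubic (C₁ C₂ : ℝ) : Continuous (cubic C₁ C₂) := by
  unfold cubic
  fun_prop

lemma exists_root_mem_Ioo {C₁ C₂ a b : ℝ} (hab : a < b)
    (h : cubic C₁ C₂ a * cubic C₁ C₂ b < 0) : ∃ x ∈ Ioo a b, cubic C₁ C₂ x = 0 := by
  have hc := (continuous_cubic C₁ C₂).continuousOn (s := Icc a b)
  rcases mul_neg_iff.1 h with ⟨ha, hb⟩ | ⟨ha, hb⟩
  · exact intermediate_value_Ioo' hab.le hc ⟨hb, ha⟩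
  · exact intermediate_value_Ioo hab.le hc ⟨ha, hb⟩

lemma exists_root (C₁ C₂ : ℝ) : ∃ x, cubic C₁ C₂ x = 0 := by
  obtain ⟨N, hN⟩ : ∃ N, N = 7 + 6 * |C₁| + |C₂| := ⟨_, rfl⟩
  have h1 := abs_nonneg C₁
  have h2 := abs_nonneg C₂
  have hN1 : 1 ≤ N := by linarith
  have hNN : N ≤ N ^ 2 := by nlinarith
  have hkey : 6 * N ^ 2 + 6 * |C₁| * N + |C₂| < N ^ 3 := by
    have e1 : |C₁| * N ≤ |C₁| * N ^ 2 := mul_le_mul_of_nonneg_left hNN h1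
    have e2 : |C₂| * 1 ≤ |C₂| * N ^ 2 := mul_le_mul_of_nonneg_left (by linarith) h2
    have e3 : N ^ 3 = N ^ 2 * (7 + 6 * |C₁| + |C₂|) := by rw [← hN]; ring
    nlinarith
  have hC1 : |C₁ * N| = |C₁| * N := by rw [abs_mul, abs_of_pos (by linarith : 0 < N)]
  have b1 := abs_le.1 hC1.le
  have b2 := abs_le.1 (le_refl |C₂|)
  obtain ⟨x, -, hx⟩ := exists_root_mem_Ioo (C₁ := C₁) (C₂ := C₂) (a := -N) (b := N) (by linarith)
    (mul_neg_of_neg_of_pos (by unfold cubic; nlinarith [b1.1, b2.2])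
      (by unfold cubic; nlinarith [b1.1, b2.1, sq_nonneg N]))
  exact ⟨x, hx⟩

/-- In region `I` the cubic has a pair of complex conjugate roots besides any real root. -/
lemma exists_complex_roots {C₁ C₂ : ℝ} (hr : (C₁, C₂) ∈ regionI) :
    ∃ α m n : ℝ, n ≠ 0 ∧ -2 * m - α = 6 ∧ m ^ 2 + n ^ 2 + 2 * α * m = 6 * C₁ ∧
      -α * (m ^ 2 + n ^ 2) = C₂ := by
  obtain ⟨α, hα⟩ := exists_root C₁ C₂
  unfold cubic at hα
  obtain ⟨z, rfl⟩ : ∃ z, α = z - 2 := ⟨α + 2, by ring⟩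
  have hpos : 0 < 3 * z ^ 2 / 4 - 6 * (2 - C₁) := by
    by_contra! hle
    rcases hr with h | ⟨h, h'⟩ | ⟨h, h'⟩
    · dsimp only at h
      nlinarith [sq_nonneg z]
    · dsimp only at h h'
      subst h
      have : z = 0 := by
        have : z ^ 2 = 0 := le_antisymm (by linarith) (sq_nonneg z)
        simpa using this
      subst this
      exact h' (by linarith)
    · dsimp only at h h'
      unfold Lplus Lminus at h'
      obtain ⟨s, hs⟩ : ∃ s, s = √(2 * (2 - C₁)) := ⟨_, rfl⟩
      have hs0 : 0 < s := by rw [hs]; exact sqrt_pos.2 (by linarith)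
      have hs2 : s ^ 2 = 2 * (2 - C₁) := by rw [hs, sq_sqrt (by linarith)]
      rw [← hs] at h'
      have habs : |z| ≤ 2 * s := abs_le_of_sq_le_sq (by linarith) (by linarith)
      obtain ⟨hl, hu⟩ := abs_le.1 habs
      obtain rfl : C₁ = 2 - s ^ 2 / 2 := by linarith
      rcases h' with h' | h'
      · nlinarith [mul_nonneg (sq_nonneg (z - s)) (by linarith : 0 ≤ z + 2 * s)]
      · nlinarith [mul_nonneg (sq_nonneg (z + s)) (by linarith : 0 ≤ 2 * s - z)]
  have hn := sq_sqrt hpos.le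
  refine ⟨z - 2, -(z + 4) / 2, √(3 * z ^ 2 / 4 - 6 * (2 - C₁)), (sqrt_pos.2 hpos).ne', by ring,
    ?_, ?_⟩
  · rw [hn]; ring
  · rw [hn]; linear_combination -hα

/-- In region `II` the cubic has three distinct real roots. -/
lemma exists_real_roots {C₁ C₂ : ℝ} (hr : (C₁, C₂) ∈ regionII) :
    ∃ a b c : ℝ, a < b ∧ b < c ∧ cubic C₁ C₂ a = 0 ∧ cubic C₁ C₂ b = 0 ∧ cubic C₁ C₂ c = 0 := by
  obtain ⟨h, hl, hu⟩ := hr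
  dsimp only at h hl hu
  unfold Lplus at hu
  unfold Lminus at hl
  obtain ⟨s, hs⟩ : ∃ s, s = √(2 * (2 - C₁)) := ⟨_, rfl⟩
  have hs0 : 0 < s := by rw [hs]; exact sqrt_pos.2 (by linarith)
  have hs2 : s ^ 2 = 2 * (2 - C₁) := by rw [hs, sq_sqrt (by linarith)]
  rw [← hs] at hl hu
  obtain rfl : C₁ = 2 - s ^ 2 / 2 := by linarith
  -- the cubic equals `C₂ - L₊` at `-2 - 2 s` and `-2 + s`, and `C₂ - L₋` at `-2 ± s`, `-2 + 2 s`
  have v1 : cubic (2 - s ^ 2 / 2) C₂ (-2 - 2 * s) < 0 := by unfold cubic; linarith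
  have v2 : 0 < cubic (2 - s ^ 2 / 2) C₂ (-2 - s) := by unfold cubic; linarith
  have v3 : cubic (2 - s ^ 2 / 2) C₂ (-2 + s) < 0 := by unfold cubic; linarith
  have v4 : 0 < cubic (2 - s ^ 2 / 2) C₂ (-2 + 2 * s) := by unfold cubic; linarith
  obtain ⟨a, ha, ha0⟩ := exists_root_mem_Ioo (by linarith) (mul_neg_of_neg_of_pos v1 v2)
  obtain ⟨b, hb, hb0⟩ := exists_root_mem_Ioo (by linarith) (mul_neg_of_pos_of_neg v2 v3)
  obtain ⟨c, hc, hc0⟩ := exists_root_mem_Ioo (by linarith) (mul_neg_of_neg_of_pos v3 v4)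
  exact ⟨a, b, c, ha.2.trans hb.1, hb.2.trans hc.1, ha0, hb0, hc0⟩

/-- What distinguishes the model `f` globally: it has a pole, or it takes the value `f 0` only
once, or it is the bounded profile of region `II`. -/
def ModelAlternative (C₁ C₂ : ℝ) (S : Set ℝ) (f : ℝ → ℝ) : Prop :=
  S.Nonempty ∨ (∀ t, f t = f 0 → t = 0) ∨
    ∃ a b c, (C₁, C₂) ∈ regionII ∧ a < b ∧ b < c ∧ cubic C₁ C₂ a = 0 ∧ cubic C₁ C₂ b = 0 ∧
      cubic C₁ C₂ c = 0 ∧ f = profile3 a b c 0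

/-- Every value at which the first integral leaves room for a nonzero derivative is taken by some
table model. -/
lemma exists_tableModel {C₁ C₂ h : ℝ} (hh : cubic C₁ C₂ h < 0) :
    ∃ S f, IsTableModel C₁ C₂ S f ∧ (∃ t ∉ S, f t = h) ∧ ModelAlternative C₁ C₂ S f := by
  have of_regionI (hr : (C₁, C₂) ∈ regionI) : ∃ S f, IsTableModel C₁ C₂ S f ∧
      (∃ t ∉ S, f t = h) ∧ ModelAlternative C₁ C₂ S f := by
    obtain ⟨α, m, n, hn, h1, h2, h3⟩ := exists_complex_roots hr
    obtain ⟨S, f, hm, hS, hsurj⟩ := exists_tableModel_regionI hr hn h1 h2 h3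
    exact ⟨S, f, hm, hsurj h hh, .inl hS⟩
  rcases lt_trichotomy C₁ 2 with hC | rfl | hC
  · obtain ⟨s, hs⟩ : ∃ s, s = √(2 * (2 - C₁)) := ⟨_, rfl⟩
    have hs2 : s ^ 2 = 2 * (2 - C₁) := by rw [hs, sq_sqrt (by linarith)]
    rcases lt_trichotomy C₂ (Lplus C₁) with hp | hp | hp
    · rcases lt_trichotomy C₂ (Lminus C₁) with hl | hl | hl
      · exact of_regionI (.inr (.inr ⟨hC, .inr hl⟩))
      · obtain ⟨S, f, hm, ht, halt⟩ := exists_tableModel_gammaMinus (C₂ := C₂) ⟨hC, hl⟩ hs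
          (fun x => by
            rw [hl, Lminus, ← hs]
            unfold cubic
            linear_combination (3 * x + 6 + 2 * s) * hs2) hh
        exact ⟨S, f, hm, ht, halt.elim .inl fun h => .inr (.inl h)⟩
      · have hr : (C₁, C₂) ∈ regionII := ⟨hC, hl, hp⟩
        obtain ⟨a, b, c, hab, hbc, ha, hb, hc⟩ := exists_real_roots hr
        rcases lt_or_ge h a with hlt | hge
        · obtain ⟨S, f, hm, hS, hsurj⟩ :=
            exists_tableModel_regionII_unbounded hr hab hbc ha hb hc
          exact ⟨S, f, hm, hsurj h hlt, .inl hS⟩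
        · have hneg := hh
          rw [cubic_eq_of_roots hab hbc ha hb hc] at hneg
          have hbh : b < h := by
            by_contra! hle
            nlinarith [mul_nonneg (mul_nonneg (sub_nonneg.2 hge) (sub_nonneg.2 hle))
              (by linarith : 0 ≤ c - h)]
          have hhc : h < c := by
            by_contra! hle
            nlinarith [mul_nonneg (mul_nonneg (sub_nonneg.2 hge) (by linarith : 0 ≤ h - b))
              (sub_nonneg.2 hle)]
          obtain ⟨t, ht⟩ := exists_profile3_eq hab hbc hbh hhc
          exact ⟨∅, _, ⟨isModel_profile3 hab hbc ha hb hc, fun τ =>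
            ⟨_, .regIIbounded hr a b c _ hab hbc ha hb hc, profile3_translate (hab.trans hbc) τ⟩⟩,
            ⟨t, notMem_empty _, ht⟩, .inr (.inr ⟨a, b, c, hr, hab, hbc, ha, hb, hc, rfl⟩)⟩
    · obtain ⟨S, f, hm, hS, hsurj⟩ := exists_tableModel_gammaPlus (C₂ := C₂) ⟨hC, hp⟩ hs
        (fun x => by
          rw [hp, Lplus, ← hs]
          unfold cubic
          linear_combination (3 * x + 6 - 2 * s) * hs2)
      exact ⟨S, f, hm, hsurj h hh, .inl hS⟩
    · exact of_regionI (.inr (.inr ⟨hC, .inl hp⟩))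
  · rcases eq_or_ne C₂ 8 with rfl | hne
    · obtain ⟨S, f, hm, hS, hsurj⟩ := exists_tableModel_pointP0
      exact ⟨S, f, hm, hsurj h hh, .inl hS⟩
    · exact of_regionI (.inr (.inl ⟨rfl, hne⟩))
  · exact of_regionI (.inl hC)

/-- A solution of the profile equation on an interval is constant or a translate of a table
model, whose poles it avoids. -/
theorem IsProfileSolution.eq_const_or_translate {C₁ : ℝ} {g g' : ℝ → ℝ} {J : Set ℝ}
    (hg : IsProfileSolution C₁ g g' J) (hJ : IsOpen J) (hJc : IsPreconnected J)
    (hne : J.Nonempty) :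
    (∃ A, A ^ 2 + 4 * A + 2 * C₁ = 0 ∧ ∀ t ∈ J, g t = A) ∨
    ∃ C₂ S f, IsTableModel C₁ C₂ S f ∧ ModelAlternative C₁ C₂ S f ∧
      ∃ τ, ∀ t ∈ J, t + τ ∉ S ∧ g t = f (t + τ) := by
  obtain ⟨C₂, hE⟩ := hg.exists_energy hJ hJc
  by_cases hzero : ∀ t ∈ J, g' t = 0
  · left
    obtain ⟨A, hA⟩ := hJ.exists_is_const_of_deriv_eq_zero hJc
      (fun t ht => (hg t ht).1.differentiableAt.differentiableWithinAt)
      fun t ht => (hg t ht).1.deriv.trans (hzero t ht)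
    obtain ⟨t, ht⟩ := hne
    refine ⟨A, ?_, hA⟩
    have h2 : HasDerivAt g' 0 t := (hasDerivAt_const t (0 : ℝ)).congr_of_eventuallyEq
      (Filter.eventually_of_mem (hJ.mem_nhds ht) hzero)
    have := (hg t ht).2.unique h2
    rw [hA t ht] at this
    linarith
  · right
    push Not at hzero
    obtain ⟨t₀, ht₀, h0⟩ := hzero
    have hneg : cubic C₁ C₂ (g t₀) < 0 := by
      have := hE t₀ ht₀
      have : 0 < g' t₀ ^ 2 := by positivity
      linarith
    obtain ⟨S, f, hm, ⟨t₁, ht₁, e⟩, halt⟩ := exists_tableModel hneg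
    obtain ⟨f', hf'⟩ := hm.1
    exact ⟨C₂, S, f, hm, halt, hf'.exists_eq_translate hJ hJc hg hE ht₀ ht₁ e⟩

/-- A solution of the profile equation on an interval is a table profile and analytic. -/
theorem IsProfileSolution.exists_tableProfile {C₁ : ℝ} {g g' : ℝ → ℝ} {J : Set ℝ}
    (hg : IsProfileSolution C₁ g g' J) (hJ : IsOpen J) (hJc : IsPreconnected J)
    (hne : J.Nonempty) :
    ∃ C₂ f, IsTableProfile C₁ C₂ f ∧ ∀ t ∈ J, g t = f t ∧ AnalyticAt ℝ g t := by
  rcases hg.eq_const_or_translate hJ hJc hne with ⟨A, hA, hgA⟩ | ⟨C₂, S, f, hm, -, τ, hτ⟩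
  · refine ⟨-(A ^ 3 + 6 * A ^ 2 + 6 * C₁ * A), fun _ => A, .singular A ?_ ?_,
      fun t ht => ⟨hgA t ht, ?_⟩⟩
    · unfold cubic; ring
    · linarith
    · exact analyticAt_const.congr (Filter.eventually_of_mem (hJ.mem_nhds ht)
        fun s hs => (hgA s hs).symm)
  · obtain ⟨F, hF, hFt⟩ := hm.2 τ
    obtain ⟨f', hf'⟩ := hm.1
    refine ⟨C₂, F, hF, fun t ht => ⟨by rw [hFt, (hτ t ht).2], ?_⟩⟩
    exact ((hf'.analyticAt _ (hτ t ht).1).comp (f := fun t => t + τ) (by fun_prop)).congr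
      (Filter.eventually_of_mem (hJ.mem_nhds ht) fun s hs => (hτ s hs).2.symm)

/-! ### The flux bound for periodic elliptic profiles -/

/-- A strict Chebyshev inequality: the mean of a decreasing function is less than its mean with
respect to a decreasing weight. -/
lemma integral_lt_of_weighted_integral_eq {L μ : ℝ} {e φ : ℝ → ℝ} (hL : 0 < L)
    (he : ContinuousOn e (Icc 0 L)) (hφ : ContinuousOn φ (Icc 0 L))
    (hea : StrictAntiOn e (Icc 0 L)) (hφa : StrictAntiOn φ (Icc 0 L)) (hφL : φ L = 0)
    (h0 : ∫ t in (0 : ℝ)..L, (μ - e t) * φ t = 0) : ∫ t in (0 : ℝ)..L, e t < μ * L := by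
  have hl : (0 : ℝ) ∈ Icc 0 L := left_mem_Icc.2 hL.le
  have hr : L ∈ Icc 0 L := right_mem_Icc.2 hL.le
  have hei : IntervalIntegrable e MeasureTheory.volume 0 L :=
    ContinuousOn.intervalIntegrable (by rwa [uIcc_of_le hL.le])
  have hint : IntervalIntegrable (fun t => (μ - e t) * φ t) MeasureTheory.volume 0 L :=
    ContinuousOn.intervalIntegrable (by
      rw [uIcc_of_le hL.le]
      exact (continuousOn_const.sub he).mul hφ)
  have hsub : ∫ t in (0 : ℝ)..L, (μ - e t) = μ * L - ∫ t in (0 : ℝ)..L, e t := by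
    rw [intervalIntegral.integral_sub (by simp) hei]
    simp [mul_comm]
  -- it suffices to find a value of the weight at which the sign of `μ - e` changes
  have key {t₁ : ℝ} (ht₁ : t₁ ∈ Ico 0 L) (hle : ∀ t ∈ Icc 0 L, t ≤ t₁ → μ ≤ e t)
      (hge : ∀ t ∈ Icc 0 L, t₁ ≤ t → e t ≤ μ) : ∫ t in (0 : ℝ)..L, e t < μ * L := by
    have ht₁' : t₁ ∈ Icc 0 L := ⟨ht₁.1, ht₁.2.le⟩
    have hφ1 : 0 < φ t₁ := hφL ▸ hφa ht₁' hr ht₁.2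
    have hpos : 0 < ∫ t in (0 : ℝ)..L, (μ - e t) * (φ t₁ - φ t) := by
      refine intervalIntegral.integral_pos hL ((continuousOn_const.sub he).mul
        (continuousOn_const.sub hφ)) (fun t ht => ?_) ⟨L, hr, ?_⟩
      · have ht' : t ∈ Icc 0 L := ⟨ht.1.le, ht.2⟩
        rcases le_total t t₁ with h | h
        · exact mul_nonneg_of_nonpos_of_nonpos (by linarith [hle t ht' h])
            (by linarith [hφa.antitoneOn ht' ht₁' h])
        · exact mul_nonneg (by linarith [hge t ht' h]) (by linarith [hφa.antitoneOn ht₁' ht' h])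
      · refine mul_pos ?_ (by rw [hφL]; linarith)
        linarith [hea ht₁' hr ht₁.2, hge t₁ ht₁' le_rfl]
    have hexp : ∫ t in (0 : ℝ)..L, (μ - e t) * (φ t₁ - φ t)
        = φ t₁ * (μ * L - ∫ t in (0 : ℝ)..L, e t) := by
      have hfun : (fun t => (μ - e t) * (φ t₁ - φ t))
          = fun t => φ t₁ * (μ - e t) - (μ - e t) * φ t := by
        funext t
        ring
      rw [hfun, intervalIntegral.integral_sub (((by simp : IntervalIntegrable (fun _ => μ)
        MeasureTheory.volume 0 L).sub hei).const_mul _) hint, h0, sub_zero,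
        intervalIntegral.integral_const_mul, hsub]
    rw [hexp] at hpos
    linarith [pos_of_mul_pos_right hpos hφ1.le]
  rcases le_or_gt (e 0) μ with h | h
  · have hlt : ∫ t in (0 : ℝ)..L, e t < ∫ t in (0 : ℝ)..L, μ :=
      intervalIntegral.integral_lt_integral_of_continuousOn_of_le_of_exists_lt hL he
        continuousOn_const
        (fun t ht => (hea.antitoneOn hl ⟨ht.1.le, ht.2⟩ ht.1.le).trans h)
        ⟨L, hr, (hea hl hr hL).trans_le h⟩
    simpa [mul_comm] using hlt
  · rcases le_or_gt μ (e L) with h' | h'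
    · have hneg : 0 < ∫ t in (0 : ℝ)..L, (e t - μ) * φ t := by
        refine intervalIntegral.integral_pos hL ((he.sub continuousOn_const).mul hφ)
          (fun t ht => ?_) ⟨0, hl, mul_pos (by linarith) (hφL ▸ hφa hl hr hL)⟩
        have ht' : t ∈ Icc 0 L := ⟨ht.1.le, ht.2⟩
        refine mul_nonneg ?_ (hφL ▸ hφa.antitoneOn ht' hr ht.2)
        linarith [hea.antitoneOn ht' hr ht.2]
      have : ∫ t in (0 : ℝ)..L, (e t - μ) * φ t = -∫ t in (0 : ℝ)..L, (μ - e t) * φ t := by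
        rw [← intervalIntegral.integral_neg]
        congr 1
        funext t
        ring
      rw [this, h0] at hneg
      simp at hneg
    · obtain ⟨t₁, ht₁, e1⟩ := intermediate_value_Icc' hL.le he ⟨h'.le, h.le⟩
      have hne : t₁ ≠ L := by rintro rfl; linarith
      exact key ⟨ht₁.1, lt_of_le_of_ne ht₁.2 hne⟩
        (fun t ht h => e1 ▸ hea.antitoneOn ht ht₁ h) (fun t ht h => e1 ▸ hea.antitoneOn ht₁ ht h)

/-- Global uniqueness for the profile equation. -/
lemma IsProfileSolution.eq_of_cauchy_data {C₁ t₀ : ℝ} {f f' g g' : ℝ → ℝ}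
    (hf : IsProfileSolution C₁ f f' univ) (hg : IsProfileSolution C₁ g g' univ)
    (h0 : f t₀ = g t₀) (h1 : f' t₀ = g' t₀) : f = g := by
  have cont {a a' : ℝ → ℝ} (ha : IsProfileSolution C₁ a a' univ) : Continuous a ∧ Continuous a' :=
    ⟨continuous_iff_continuousAt.2 fun t => (ha t trivial).1.continuousAt,
      continuous_iff_continuousAt.2 fun t => (ha t trivial).2.continuousAt⟩
  have hclosed : IsClosed {t | f t = g t ∧ f' t = g' t} :=
    (isClosed_eq (cont hf).1 (cont hg).1).inter (isClosed_eq (cont hf).2 (cont hg).2)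
  have hopen : IsOpen {t | f t = g t ∧ f' t = g' t} := isOpen_iff_mem_nhds.2 fun t ht =>
    eventually_eq_of_cauchy_data Filter.univ_mem hf hg ht.1 ht.2
  have := IsClopen.eq_univ ⟨hclosed, hopen⟩ ⟨t₀, h0, h1⟩
  funext t
  exact (this.symm ▸ mem_univ t : t ∈ {t | f t = g t ∧ f' t = g' t}).1

section Periodic

variable {C₁ C₂ a b c : ℝ} {n : ℕ}

lemma profile3_zero_apply (a b c t : ℝ) : profile3 a b c 0 t = c - (c - b) *
    sin (jacobiAm (√((c - a) / 6) * t) (√((c - b) / (c - a)))) ^ 2 := by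
  simp only [profile3, mul_zero, add_zero]

lemma profile3_periodic (hab : a < b) (hbc : b < c) (hn : 0 < n)
    (hK : π * √((c - a) / 6) = n * ellipticK (√((c - b) / (c - a)))) :
    Function.Periodic (profile3 a b c 0) (2 * π / n) := by
  intro t
  obtain ⟨-, hk1⟩ := modulus_sq hab hbc
  have hn' : (n : ℝ) ≠ 0 := by positivity
  rw [profile3_zero_apply, profile3_zero_apply,
    show √((c - a) / 6) * (t + 2 * π / n) = √((c - a) / 6) * t
      + 2 * ellipticK (√((c - b) / (c - a))) by field_simp; linear_combination 2 * hK,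
    jacobiAm_add_two_mul_ellipticK hk1, sin_add_pi, neg_sq]

/-- On half a period the bounded profile decreases from `c` to `b`. -/
lemma profile3_strictAntiOn (hab : a < b) (hbc : b < c) (hn : 0 < n)
    (hK : π * √((c - a) / 6) = n * ellipticK (√((c - b) / (c - a)))) :
    StrictAntiOn (profile3 a b c 0) (Icc 0 (π / n)) ∧ profile3 a b c 0 0 = c ∧
      profile3 a b c 0 (π / n) = b := by
  obtain ⟨-, hk1⟩ := modulus_sq hab hbc
  obtain ⟨-, hν0⟩ := frequency_sq hab hbc
  have hn' : (n : ℝ) ≠ 0 := by positivity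
  have hend : jacobiAm (√((c - a) / 6) * (π / n)) (√((c - b) / (c - a))) = π / 2 := by
    rw [show √((c - a) / 6) * (π / n) = ellipticF (π / 2) (√((c - b) / (c - a))) by
      rw [← ellipticK]; field_simp; linear_combination hK, jacobiAm_ellipticF hk1]
  refine ⟨fun x hx y hy hxy => ?_, ?_, ?_⟩
  · have hm := jacobiAm_strictMono hk1
    have h0x : 0 ≤ jacobiAm (√((c - a) / 6) * x) (√((c - b) / (c - a))) := by
      rw [← jacobiAm_zero hk1]
      exact hm.monotone (mul_nonneg hν0.le hx.1)
    have hxy' := hm (mul_lt_mul_of_pos_left hxy hν0)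
    have hy2 : jacobiAm (√((c - a) / 6) * y) (√((c - b) / (c - a))) ≤ π / 2 := by
      rw [← hend]
      exact hm.monotone (mul_le_mul_of_nonneg_left hy.2 hν0.le)
    dsimp only at hxy'
    rw [profile3_zero_apply, profile3_zero_apply]
    have h1 := sin_lt_sin_of_lt_of_le_pi_div_two (by linarith [pi_pos]) hy2 hxy'
    have h2 := sin_nonneg_of_nonneg_of_le_pi h0x (by linarith [pi_pos])
    have h3 := mul_lt_mul_of_pos_left (pow_lt_pow_left₀ h1 h2 two_ne_zero) (sub_pos.2 hbc)
    linarith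
  · rw [profile3_zero_apply, mul_zero, jacobiAm_zero hk1]
    simp
  · rw [profile3_zero_apply, hend]
    simp

/-- Translation by half a period acts on the bounded profile by the involution of the projective
line that fixes `∞ ↔ a` and exchanges `b` and `c`: it preserves the elliptic curve
`y² = (h - a)(h - b)(h - c)`. -/
lemma profile3_mul_reflect (hab : a < b) (hbc : b < c) (hn : 0 < n)
    (ha : cubic C₁ C₂ a = 0) (hb : cubic C₁ C₂ b = 0) (hc : cubic C₁ C₂ c = 0)
    (hK : π * √((c - a) / 6) = n * ellipticK (√((c - b) / (c - a)))) (t : ℝ) :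
    (profile3 a b c 0 t - a) * (profile3 a b c 0 (π / n - t) - a) = (c - a) * (b - a) := by
  obtain ⟨f', hm⟩ := isModel_profile3 hab hbc ha hb hc
  obtain ⟨-, h0, h1⟩ := profile3_strictAntiOn hab hbc hn hK
  have hlow (t : ℝ) : 0 < profile3 a b c 0 t - a := by
    rw [profile3_zero_apply]
    nlinarith [sin_sq_le_one (jacobiAm (√((c - a) / 6) * t) (√((c - b) / (c - a))))]
  generalize profile3 a b c 0 = h at *
  have hd (t : ℝ) := hm.isSolution t (by simp)
  have hE (t : ℝ) := hm.energy t (notMem_empty t)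
  have hf0 : f' 0 = 0 := by
    have := hE 0
    rw [h0, hc, mul_zero] at this
    simpa using this
  have hf1 : f' (π / n) = 0 := by
    have := hE (π / n)
    rw [h1, hb, mul_zero] at this
    simpa using this
  have sol1 : IsProfileSolution C₁ (fun t => h (π / n - t)) (fun t => -f' (π / n - t)) univ := by
    intro t _
    have e1 := (hd (π / n - t)).1.scomp t ((hasDerivAt_id t).const_sub (π / n))
    have e2 := ((hd (π / n - t)).2.scomp t ((hasDerivAt_id t).const_sub (π / n))).neg
    exact ⟨by simpa [Function.comp_def] using e1, by simpa [Function.comp_def] using! e2⟩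
  have sol2 : IsProfileSolution C₁ (fun t => a + (c - a) * (b - a) / (h t - a))
      (fun t => -((c - a) * (b - a)) * f' t / (h t - a) ^ 2) univ := by
    intro t _
    have hne := (hlow t).ne'
    constructor
    · refine (((hasDerivAt_const t _).fun_div ((hd t).1.sub_const a) hne).const_add a).congr_deriv
        ?_
      ring
    · refine (((hd t).2.const_mul _).fun_div (((hd t).1.sub_const a).fun_pow 2)
        (pow_ne_zero 2 hne)).congr_deriv ?_
      have hEt := hE t
      have hid := cubic_eq_of_roots hab hbc ha hb hc
      have i0 := hid (h t)
      rw [i0] at hEt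
      have i1 := hid 0
      have i2 := hid 1
      have i3 := hid (-1)
      unfold cubic at i1 i2 i3
      have s1 : a = -6 - b - c := by linarith
      have s2 : 6 * C₁ = a * b + b * c + c * a := by linarith
      have hrhs (x : ℝ) : -(a + x) ^ 2 - 4 * (a + x) - 2 * C₁
          = -(1 / 3) * (3 * x ^ 2 - 2 * ((b - a) + (c - a)) * x + (c - a) * (b - a)) := by
        linear_combination (-(2 / 3) * x - (2 / 3) * a) * s1 - (1 / 3) * s2
      rw [hrhs, show h t = a + (h t - a) by ring, hrhs, add_sub_cancel_left]
      rw [show (h t - a) * (h t - b) * (h t - c)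
        = (h t - a) * ((h t - a) - (b - a)) * ((h t - a) - (c - a)) by ring] at hEt
      generalize h t - a = X at *
      generalize f' t = y at *
      generalize b - a = p at *
      generalize c - a = q at *
      norm_num
      field_simp
      linear_combination (6 * p * q) * hEt
  have := congrFun (sol2.eq_of_cauchy_data sol1 (t₀ := 0)
    (by simp only [h0, sub_zero, h1]; rw [mul_div_cancel_left₀ _ (by linarith : c - a ≠ 0)]; ring)
    (by simp only [hf0, sub_zero, hf1]; simp)) t
  rw [← this]
  have hne := (hlow t).ne'
  field_simp
  ring

/-- The integral of the bounded profile over a quarter period and its reflection. With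
`d = h(t) - h(π/n - t)` and `e = h(t) + h(π/n - t) + 4` the profile equation gives `d'' = -e d`,
so that `n² - e` is orthogonal to the decreasing weight `d cos (n t)`. -/
lemma integral_profile3_quarter_lt (hab : a < b) (hbc : b < c) (hn : 0 < n)
    (ha : cubic C₁ C₂ a = 0) (hb : cubic C₁ C₂ b = 0) (hc : cubic C₁ C₂ c = 0)
    (hK : π * √((c - a) / 6) = n * ellipticK (√((c - b) / (c - a)))) :
    ∫ t in (0 : ℝ)..π / (2 * n),
      (profile3 a b c 0 t + profile3 a b c 0 (π / n - t) + 4) < n ^ 2 * (π / (2 * n)) := by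
  obtain ⟨f', hm⟩ := isModel_profile3 hab hbc ha hb hc
  obtain ⟨hanti, h0, h1⟩ := profile3_strictAntiOn hab hbc hn hK
  have hinv := profile3_mul_reflect hab hbc hn ha hb hc hK
  generalize profile3 a b c 0 = h at *
  have hn0 : (0 : ℝ) < n := by positivity
  obtain ⟨L, hL⟩ : ∃ L, L = π / (2 * n) := ⟨_, rfl⟩
  have hL2 : π / n = 2 * L := by rw [hL]; field_simp
  rw [← hL]
  rw [hL2] at hanti h1 hinv ⊢
  have hL0 : 0 < L := by rw [hL]; positivity
  have hnL : n * L = π / 2 := by rw [hL]; field_simp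
  have hd (t : ℝ) := hm.isSolution t (by simp)
  have hE (t : ℝ) := hm.energy t (notMem_empty t)
  have hf0 : f' 0 = 0 := by
    have := hE 0
    rw [h0, hc, mul_zero] at this
    simpa using this
  have hf1 : f' (2 * L) = 0 := by
    have := hE (2 * L)
    rw [h1, hb, mul_zero] at this
    simpa using this
  have hcont : Continuous h := continuous_iff_continuousAt.2 fun t => (hd t).1.continuousAt
  have hanti_d {x y : ℝ} (hx : x ∈ Icc 0 L) (hy : y ∈ Icc 0 L) (hxy : x < y) :
      h y < h x ∧ h (2 * L - x) < h (2 * L - y) :=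
    ⟨hanti ⟨hx.1, by linarith [hx.2]⟩ ⟨hy.1, by linarith [hy.2]⟩ hxy,
      hanti ⟨by linarith [hy.2], by linarith [hy.1]⟩ ⟨by linarith [hx.2], by linarith [hx.1]⟩
        (by linarith)⟩
  have hdL : h L - h (2 * L - L) = 0 := by rw [show 2 * L - L = L by ring, sub_self]
  have hd_nonneg {x : ℝ} (hx : x ∈ Icc 0 L) : 0 ≤ h x - h (2 * L - x) := by
    rcases eq_or_lt_of_le hx.2 with rfl | hlt
    · exact hdL.ge
    · linarith [hanti_d hx (right_mem_Icc.2 hL0.le) hlt]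
  refine integral_lt_of_weighted_integral_eq
    (φ := fun t => (h t - h (2 * L - t)) * cos (n * t)) hL0 (by fun_prop) (by fun_prop) ?_ ?_
    (by rw [hdL, zero_mul]) ?_
  · -- `e` is an increasing function of `X = h(t) - a` where `X² > (c - a) (b - a)`
    intro x hx y hy hxy
    obtain ⟨d1, d2⟩ := hanti_d hx hy hxy
    have px := hinv x
    have py := hinv y
    have hdy := hd_nonneg hy
    have hlow : a < h (2 * L - x) := by
      have : h (2 * L) ≤ h (2 * L - x) := hanti.antitoneOn
        ⟨by linarith [hx.2], by linarith [hx.1]⟩ ⟨by linarith, le_rfl⟩ (by linarith [hx.1])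
      linarith
    have hlow' : a < h (2 * L - y) := hlow.trans d2
    dsimp only
    obtain ⟨X, hX⟩ : ∃ X, X = h x - a := ⟨_, rfl⟩
    obtain ⟨X', hX'⟩ : ∃ X', X' = h (2 * L - x) - a := ⟨_, rfl⟩
    obtain ⟨Y, hY⟩ : ∃ Y, Y = h y - a := ⟨_, rfl⟩
    obtain ⟨Y', hY'⟩ : ∃ Y', Y' = h (2 * L - y) - a := ⟨_, rfl⟩
    rw [← hX, ← hX'] at px
    rw [← hY, ← hY'] at py
    have : (X - Y) * Y' = X * (Y' - X') := by linear_combination px - py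
    have e1 : Y' < X := by linarith
    have e2 : 0 < Y' - X' := by linarith
    have e3 : 0 < Y' := by linarith
    have e4 : Y' - X' < X - Y := by
      by_contra! hle
      nlinarith [mul_le_mul_of_nonneg_right hle e3.le, mul_lt_mul_of_pos_right e1 e2]
    linarith
  · intro x hx y hy hxy
    obtain ⟨d1, d2⟩ := hanti_d hx hy hxy
    have hcos : cos (n * y) < cos (n * x) := by
      refine strictAntiOn_cos ⟨by have := hx.1; positivity, ?_⟩ ⟨by have := hy.1; positivity, ?_⟩
        (mul_lt_mul_of_pos_left hxy hn0)
      · nlinarith [hx.2, pi_pos]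
      · nlinarith [hy.2, pi_pos]
    have hcos0 : 0 ≤ cos (n * y) := by
      refine cos_nonneg_of_neg_pi_div_two_le_of_le ?_ ?_
      · have : 0 ≤ n * y := by have := hy.1; positivity
        linarith [pi_pos]
      · nlinarith [hy.2]
    exact mul_lt_mul'' (by linarith) hcos (hd_nonneg hy) hcos0
  · have hW (t : ℝ) : HasDerivAt (fun t => (f' t + f' (2 * L - t)) * cos (n * t)
        + n * (h t - h (2 * L - t)) * sin (n * t))
        ((n ^ 2 - (h t + h (2 * L - t) + 4)) * ((h t - h (2 * L - t)) * cos (n * t))) t := by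
      have hlin : HasDerivAt (fun t : ℝ => n * t) n t := by
        simpa using (hasDerivAt_id t).const_mul (n : ℝ)
      have hr : HasDerivAt (fun t : ℝ => 2 * L - t) (-1) t := (hasDerivAt_id t).const_sub (2 * L)
      have r0 : HasDerivAt (fun t => h (2 * L - t)) (-f' (2 * L - t)) t := by
        simpa [Function.comp_def] using (hd (2 * L - t)).1.scomp t hr
      have r1 : HasDerivAt (fun t => f' (2 * L - t))
          (-(-h (2 * L - t) ^ 2 - 4 * h (2 * L - t) - 2 * C₁)) t := by
        simpa [Function.comp_def] using! (hd (2 * L - t)).2.scomp t hr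
      refine ((((hd t).2.fun_add r1).fun_mul hlin.cos).fun_add
        ((((hd t).1.fun_sub r0).const_mul (n : ℝ)).fun_mul hlin.sin)).congr_deriv ?_
      ring
    rw [intervalIntegral.integral_eq_sub_of_hasDerivAt (fun t _ => hW t)
      (Continuous.intervalIntegrable (by fun_prop) _ _), hnL, hdL]
    simp [hf0, hf1]

/-- The flux bound for the bounded profile of region `II` with minimal period `2 π / n`. -/
theorem profile3_flux_lt (hab : a < b) (hbc : b < c) (hn : 0 < n)
    (ha : cubic C₁ C₂ a = 0) (hb : cubic C₁ C₂ b = 0) (hc : cubic C₁ C₂ c = 0)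
    (hK : π * √((c - a) / 6) = n * ellipticK (√((c - b) / (c - a)))) (δ : ℝ) :
    4 + (∫ θ in (0 : ℝ)..(2 * π), profile3 a b c 0 (θ + δ)) / π < (n : ℝ) ^ 2 := by
  have hquarter := integral_profile3_quarter_lt hab hbc hn ha hb hc hK
  have hper := profile3_periodic hab hbc hn hK
  obtain ⟨f', hm⟩ := isModel_profile3 hab hbc ha hb hc
  have heven (t : ℝ) : profile3 a b c 0 (-t) = profile3 a b c 0 t := hm.even t (notMem_empty t)
  generalize profile3 a b c 0 = h at *
  have hcont : Continuous h :=
    continuous_iff_continuousAt.2 fun t => (hm.isSolution t (by simp)).1.continuousAt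
  have hi (x y : ℝ) : IntervalIntegrable h MeasureTheory.volume x y := hcont.intervalIntegrable x y
  have hn0 : (0 : ℝ) < n := by positivity
  obtain ⟨L, hL⟩ : ∃ L, L = π / (2 * n) := ⟨_, rfl⟩
  have hL2 : π / n = 2 * L := by rw [hL]; field_simp
  have hL4 : 2 * π / n = 4 * L := by rw [hL]; field_simp; norm_num
  have hπ : π = 2 * n * L := by rw [hL]; field_simp
  have hL0 : 0 < L := by rw [hL]; positivity
  rw [← hL, hL2] at hquarter
  rw [hL4] at hper
  have hhalf : ∫ t in (0 : ℝ)..2 * L, h t = ∫ t in (0 : ℝ)..L, (h t + h (2 * L - t)) := by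
    rw [intervalIntegral.integral_add (hi _ _)
      (Continuous.intervalIntegrable (by fun_prop) _ _), intervalIntegral.integral_comp_sub_left,
      ← intervalIntegral.integral_add_adjacent_intervals (hi 0 L) (hi L (2 * L)), sub_zero]
    rw [show 2 * L - L = L by ring]
  have hfull : ∫ t in (0 : ℝ)..4 * L, h t = 2 * ∫ t in (0 : ℝ)..2 * L, h t := by
    have e1 := hper.intervalIntegral_add_eq 0 (-(2 * L))
    rw [zero_add, show -(2 * L) + 4 * L = 2 * L by ring] at e1
    have e2 := intervalIntegral.integral_comp_neg (a := -(2 * L)) (b := 0) h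
    simp only [heven, neg_zero, neg_neg] at e2
    rw [e1, ← intervalIntegral.integral_add_adjacent_intervals (hi (-(2 * L)) 0) (hi 0 (2 * L)), e2]
    ring
  have hall : ∫ θ in (0 : ℝ)..(2 * π), h (θ + δ) = n * ∫ t in (0 : ℝ)..4 * L, h t := by
    have e1 := hper.intervalIntegral_add_zsmul_eq (n : ℤ) δ (fun x y => hi x y)
    have e2 := hper.intervalIntegral_add_eq δ 0
    rw [zero_add] at e2
    rw [intervalIntegral.integral_comp_add_right, zero_add, ← e2]
    simp only [zsmul_eq_mul, Int.cast_natCast] at e1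
    rw [← e1]
    congr 1
    rw [hπ]
    ring
  rw [intervalIntegral.integral_add (Continuous.intervalIntegrable (by fun_prop) _ _)
    (by simp), ← hhalf, intervalIntegral.integral_const, smul_eq_mul, sub_zero] at hquarter
  rw [hall, hfull, hπ]
  have : n * (2 * ∫ t in (0 : ℝ)..2 * L, h t) / (2 * n * L) = (∫ t in (0 : ℝ)..2 * L, h t) / L := by
    field_simp
  rw [this, ← lt_sub_iff_add_lt', div_lt_iff₀ hL0]
  linarith

end Periodic

/-! ### Homogeneous functions on cones and reduction to the profile equation -/

/-- The cone over a set `J` of polar angles. -/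
def cone (J : Set ℝ) : Set (ℝ × ℝ) :=
  {q | ∃ r : ℝ, 0 < r ∧ ∃ θ ∈ J, q = (r * cos θ, r * sin θ)}

lemma mem_cone {J : Set ℝ} {r θ : ℝ} (hr : 0 < r) (hθ : θ ∈ J) :
    (r * cos θ, r * sin θ) ∈ cone J := ⟨r, hr, θ, hθ, rfl⟩

lemma unit_mem_cone {J : Set ℝ} {θ : ℝ} (hθ : θ ∈ J) : (cos θ, sin θ) ∈ cone J :=
  ⟨1, one_pos, θ, hθ, by simp⟩

lemma sector_eq_cone (θ₁ θ₂ : ℝ) : sector θ₁ θ₂ = cone (Ioo θ₁ θ₂) := rfl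

lemma rsq_polar (r θ : ℝ) : rsq (r * cos θ, r * sin θ) = r ^ 2 := by
  unfold rsq
  linear_combination r ^ 2 * sin_sq_add_cos_sq θ

/-- The polar angle near the ray of angle `θ₀`. -/
noncomputable def localAngle (θ₀ : ℝ) (q : ℝ × ℝ) : ℝ :=
  θ₀ + arctan ((q.2 * cos θ₀ - q.1 * sin θ₀) / (q.1 * cos θ₀ + q.2 * sin θ₀))

lemma eq_polar_localAngle {θ₀ : ℝ} {q : ℝ × ℝ} (hq : 0 < q.1 * cos θ₀ + q.2 * sin θ₀) :
    0 < √(rsq q) ∧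
      q = (√(rsq q) * cos (localAngle θ₀ q), √(rsq q) * sin (localAngle θ₀ q)) := by
  obtain ⟨x, y⟩ := q
  dsimp only at hq
  obtain ⟨X, hX⟩ : ∃ X, X = x * cos θ₀ + y * sin θ₀ := ⟨_, rfl⟩
  obtain ⟨Y, hY⟩ : ∃ Y, Y = y * cos θ₀ - x * sin θ₀ := ⟨_, rfl⟩
  have hrsq : rsq (x, y) = X ^ 2 + Y ^ 2 := by
    rw [hX, hY]
    unfold rsq
    linear_combination -(x ^ 2 + y ^ 2) * sin_sq_add_cos_sq θ₀
  rw [← hX] at hq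
  have hpos : 0 < X ^ 2 + Y ^ 2 := by positivity
  have hR : 0 < √(X ^ 2 + Y ^ 2) := sqrt_pos.2 hpos
  have hs : √(1 + (Y / X) ^ 2) = √(X ^ 2 + Y ^ 2) / X := by
    rw [show 1 + (Y / X) ^ 2 = (X ^ 2 + Y ^ 2) / X ^ 2 by field_simp, sqrt_div hpos.le,
      sqrt_sq hq.le]
  have hc : √(X ^ 2 + Y ^ 2) * cos (arctan (Y / X)) = X := by
    rw [cos_arctan, hs]
    field_simp
  have hsin : √(X ^ 2 + Y ^ 2) * sin (arctan (Y / X)) = Y := by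
    rw [sin_arctan, hs]
    field_simp
  refine ⟨hrsq ▸ hR, ?_⟩
  rw [hrsq, localAngle, ← hX, ← hY, cos_add, sin_add]
  refine Prod.ext ?_ ?_
  · dsimp only
    linear_combination -cos θ₀ * hc + sin θ₀ * hsin - cos θ₀ * hX + sin θ₀ * hY
      - x * sin_sq_add_cos_sq θ₀
  · dsimp only
    linear_combination -sin θ₀ * hc - cos θ₀ * hsin - sin θ₀ * hX - cos θ₀ * hY
      - y * sin_sq_add_cos_sq θ₀

lemma inner_ray_pos {r : ℝ} (hr : 0 < r) (θ : ℝ) :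
    0 < (r * cos θ, r * sin θ).1 * cos θ + (r * cos θ, r * sin θ).2 * sin θ := by
  have : r * cos θ * cos θ + r * sin θ * sin θ = r := by
    linear_combination r * sin_sq_add_cos_sq θ
  dsimp only
  rwa [this]

lemma localAngle_ray {r : ℝ} (θ : ℝ) : localAngle θ (r * cos θ, r * sin θ) = θ := by
  rw [localAngle, show r * sin θ * cos θ - r * cos θ * sin θ = 0 by ring]
  simp

lemma analyticAt_localAngle {r : ℝ} (hr : 0 < r) (θ : ℝ) :
    AnalyticAt ℝ (localAngle θ) (r * cos θ, r * sin θ) := by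
  have h : AnalyticAt ℝ (fun q : ℝ × ℝ =>
      (q.2 * cos θ - q.1 * sin θ) / (q.1 * cos θ + q.2 * sin θ)) (r * cos θ, r * sin θ) := by
    refine AnalyticAt.div ?_ ?_ (inner_ray_pos hr θ).ne'
    · exact (analyticAt_snd.mul analyticAt_const).sub (analyticAt_fst.mul analyticAt_const)
    · exact (analyticAt_fst.mul analyticAt_const).add (analyticAt_snd.mul analyticAt_const)
  exact analyticAt_const.add ((contDiff_arctan.contDiffAt.analyticAt).comp h)

/-- Near a point of the cone over an open set, `localAngle` is a polar angle in that set. -/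
lemma eventually_polar {J : Set ℝ} (hJ : IsOpen J) {r θ : ℝ} (hr : 0 < r) (hθ : θ ∈ J) :
    ∀ᶠ q in nhds (r * cos θ, r * sin θ), 0 < √(rsq q) ∧ localAngle θ q ∈ J ∧
      q = (√(rsq q) * cos (localAngle θ q), √(rsq q) * sin (localAngle θ q)) := by
  have h1 : ∀ᶠ q : ℝ × ℝ in nhds (r * cos θ, r * sin θ), 0 < q.1 * cos θ + q.2 * sin θ :=
    (isOpen_lt continuous_const (by fun_prop)).mem_nhds (inner_ray_pos hr θ)
  have h2 := (analyticAt_localAngle hr θ).continuousAt.eventually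
    (hJ.mem_nhds (by rwa [localAngle_ray]))
  filter_upwards [h1, h2] with q hq1 hq2
  obtain ⟨hp, he⟩ := eq_polar_localAngle hq1
  exact ⟨hp, hq2, he⟩

lemma isOpen_cone {J : Set ℝ} (hJ : IsOpen J) : IsOpen (cone J) := by
  refine isOpen_iff_mem_nhds.2 ?_
  rintro q ⟨r, hr, θ, hθ, rfl⟩
  filter_upwards [eventually_polar hJ hr hθ] with q ⟨hp, hmem, he⟩
  exact ⟨_, hp, _, hmem, he⟩

lemma contDiffOn_dX {w : ℝ × ℝ → ℝ} {D : Set (ℝ × ℝ)} (hD : IsOpen D)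
    (hw : ContDiffOn ℝ ∞ w D) : ContDiffOn ℝ ∞ (dX w) D :=
  (hw.fderiv_of_isOpen hD (m := ∞) (by simp)).clm_apply contDiffOn_const

lemma contDiffOn_dY {w : ℝ × ℝ → ℝ} {D : Set (ℝ × ℝ)} (hD : IsOpen D)
    (hw : ContDiffOn ℝ ∞ w D) : ContDiffOn ℝ ∞ (dY w) D :=
  (hw.fderiv_of_isOpen hD (m := ∞) (by simp)).clm_apply contDiffOn_const

lemma differentiableAt_of_contDiffOn {w : ℝ × ℝ → ℝ} {D : Set (ℝ × ℝ)} (hD : IsOpen D)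
    (hw : ContDiffOn ℝ ∞ w D) {q : ℝ × ℝ} (hq : q ∈ D) : DifferentiableAt ℝ w q :=
  (hw.contDiffAt (hD.mem_nhds hq)).differentiableAt (by simp)

/-- `w` is homogeneous of degree `d` on the cone over `J`, with angular profile `W`. -/
def IsHomogeneous (J : Set ℝ) (d : ℤ) (w : ℝ × ℝ → ℝ) (W : ℝ → ℝ) : Prop :=
  ∀ r θ : ℝ, 0 < r → θ ∈ J → w (r * cos θ, r * sin θ) = r ^ d * W θ

namespace IsHomogeneous

variable {J : Set ℝ} {d e : ℤ} {w z : ℝ × ℝ → ℝ} {W W' Z : ℝ → ℝ}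

lemma mul (hw : IsHomogeneous J d w W) (hz : IsHomogeneous J e z Z) :
    IsHomogeneous J (d + e) (fun q => w q * z q) (fun θ => W θ * Z θ) := by
  intro r θ hr hθ
  dsimp only
  rw [hw r θ hr hθ, hz r θ hr hθ, zpow_add₀ hr.ne']
  ring

lemma apply_unit (hw : IsHomogeneous J d w W) {θ : ℝ} (hθ : θ ∈ J) : w (cos θ, sin θ) = W θ := by
  simpa using hw 1 θ one_pos hθ

/-- Partial derivatives of a homogeneous function, from the radial and the angular one. -/
lemma partial_derivs (hJ : IsOpen J) (hw : IsHomogeneous J d w W)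
    (hd : ∀ q ∈ cone J, DifferentiableAt ℝ w q) (hW : ∀ θ ∈ J, HasDerivAt W (W' θ) θ) :
    IsHomogeneous J (d - 1) (dX w) (fun θ => d * cos θ * W θ - sin θ * W' θ) ∧
      IsHomogeneous J (d - 1) (dY w) (fun θ => d * sin θ * W θ + cos θ * W' θ) := by
  have key (r θ : ℝ) (hr : 0 < r) (hθ : θ ∈ J) :
      cos θ * dX w (r * cos θ, r * sin θ) + sin θ * dY w (r * cos θ, r * sin θ)
        = d * r ^ (d - 1) * W θ ∧
      -sin θ * dX w (r * cos θ, r * sin θ) + cos θ * dY w (r * cos θ, r * sin θ)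
        = r ^ (d - 1) * W' θ := by
    have hF := (hd _ (mem_cone hr hθ)).hasFDerivAt
    have hlin (x y : ℝ) : fderiv ℝ w (r * cos θ, r * sin θ) (x, y)
        = x * dX w (r * cos θ, r * sin θ) + y * dY w (r * cos θ, r * sin θ) := by
      rw [show ((x, y) : ℝ × ℝ) = x • (1, 0) + y • (0, 1) by simp, map_add, map_smul, map_smul]
      rfl
    constructor
    · have h1 : HasDerivAt (fun r => (r * cos θ, r * sin θ)) (cos θ, sin θ) r := by
        simpa using ((hasDerivAt_id r).mul_const (cos θ)).prodMk
          ((hasDerivAt_id r).mul_const (sin θ))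
      have h2 := hF.comp_hasDerivAt r h1
      have h3 : HasDerivAt (fun r => r ^ d * W θ) (d * r ^ (d - 1) * W θ) r :=
        (hasDerivAt_zpow d r (.inl hr.ne')).mul_const _
      rw [hlin] at h2
      exact h2.unique (h3.congr_of_eventuallyEq (Filter.eventually_of_mem (Ioi_mem_nhds hr)
        fun s hs => hw s θ hs hθ))
    · have h1 : HasDerivAt (fun θ => (r * cos θ, r * sin θ)) (r * -sin θ, r * cos θ) θ :=
        ((hasDerivAt_cos θ).const_mul r).prodMk ((hasDerivAt_sin θ).const_mul r)
      have h2 := hF.comp_hasDerivAt θ h1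
      have h3 : HasDerivAt (fun θ => r ^ d * W θ) (r ^ d * W' θ) θ := (hW θ hθ).const_mul _
      rw [hlin] at h2
      have h4 := h2.unique (h3.congr_of_eventuallyEq (Filter.eventually_of_mem (hJ.mem_nhds hθ)
        fun s hs => hw r s hr hs))
      rw [show r ^ d = r * r ^ (d - 1) by rw [← zpow_one_add₀ hr.ne']; ring_nf] at h4
      apply mul_left_cancel₀ hr.ne'
      linear_combination h4
  constructor
  · intro r θ hr hθ
    obtain ⟨k1, k2⟩ := key r θ hr hθ
    linear_combination cos θ * k1 - sin θ * k2
      - dX w (r * cos θ, r * sin θ) * sin_sq_add_cos_sq θ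
  · intro r θ hr hθ
    obtain ⟨k1, k2⟩ := key r θ hr hθ
    linear_combination sin θ * k1 + cos θ * k2
      - dY w (r * cos θ, r * sin θ) * sin_sq_add_cos_sq θ

/-- The Laplacian of a function of degree `-1` on the unit circle. -/
lemma lap_apply (hJ : IsOpen J) (hw : IsHomogeneous J (-1) w W)
    (hs : ContDiffOn ℝ ∞ w (cone J)) {W'' : ℝ → ℝ} (hW : ∀ θ ∈ J, HasDerivAt W (W' θ) θ)
    (hW' : ∀ θ ∈ J, HasDerivAt W' (W'' θ) θ) {θ : ℝ} (hθ : θ ∈ J) :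
    lap w (cos θ, sin θ) = W θ + W'' θ := by
  have hD := isOpen_cone hJ
  obtain ⟨hx, hy⟩ := hw.partial_derivs hJ (fun q => differentiableAt_of_contDiffOn hD hs) hW
  have hxx := (hx.partial_derivs hJ
    (fun q => differentiableAt_of_contDiffOn hD (contDiffOn_dX hD hs))
    (fun θ hθ => (((hasDerivAt_cos θ).const_mul (((-1 : ℤ) : ℝ))).fun_mul (hW θ hθ)).fun_sub
      ((hasDerivAt_sin θ).fun_mul (hW' θ hθ)))).1.apply_unit hθ
  have hyy := (hy.partial_derivs hJ
    (fun q => differentiableAt_of_contDiffOn hD (contDiffOn_dY hD hs))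
    (fun θ hθ => (((hasDerivAt_sin θ).const_mul (((-1 : ℤ) : ℝ))).fun_mul (hW θ hθ)).fun_add
      ((hasDerivAt_cos θ).fun_mul (hW' θ hθ)))).2.apply_unit hθ
  rw [lap, hxx, hyy]
  push_cast
  linear_combination (W θ + W'' θ) * sin_sq_add_cos_sq θ

end IsHomogeneous

/-- The momentum equations of a radial homogeneous flow in polar coordinates. -/
lemma radial_momentum {J : Set ℝ} (hJ : IsOpen J) {u v p : ℝ × ℝ → ℝ} {g g' g'' P P' : ℝ → ℝ}
    (hs : SmoothOn (cone J) u v p) (hNS : SolvesNS (cone J) u v p)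
    (hu : IsHomogeneous J (-1) u fun θ => g θ * cos θ)
    (hv : IsHomogeneous J (-1) v fun θ => g θ * sin θ) (hp : IsHomogeneous J (-2) p P)
    (hg : ∀ θ ∈ J, HasDerivAt g (g' θ) θ) (hg' : ∀ θ ∈ J, HasDerivAt g' (g'' θ) θ)
    (hP : ∀ θ ∈ J, HasDerivAt P (P' θ) θ) {θ : ℝ} (hθ : θ ∈ J) :
    g'' θ = -g θ ^ 2 - 2 * P θ ∧ P' θ = 2 * g' θ := by
  have hD := isOpen_cone hJ
  obtain ⟨su, sv, sp⟩ := hs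
  have du (q) (hq : q ∈ cone J) := differentiableAt_of_contDiffOn hD su hq
  have dv (q) (hq : q ∈ cone J) := differentiableAt_of_contDiffOn hD sv hq
  have dp (q) (hq : q ∈ cone J) := differentiableAt_of_contDiffOn hD sp hq
  have hc (θ) (hθ : θ ∈ J) := (hg θ hθ).fun_mul (hasDerivAt_cos θ)
  have hsn (θ) (hθ : θ ∈ J) := (hg θ hθ).fun_mul (hasDerivAt_sin θ)
  have lu := hu.lap_apply hJ su hc (fun θ hθ => ((hg' θ hθ).fun_mul (hasDerivAt_cos θ)).fun_add
    ((hg θ hθ).fun_mul (hasDerivAt_sin θ).fun_neg)) hθ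
  have lv := hv.lap_apply hJ sv hsn (fun θ hθ => ((hg' θ hθ).fun_mul (hasDerivAt_sin θ)).fun_add
    ((hg θ hθ).fun_mul (hasDerivAt_cos θ))) hθ
  have uu := ((hu.mul hu).partial_derivs hJ (fun q hq => (du q hq).fun_mul (du q hq))
    (fun θ hθ => (hc θ hθ).fun_mul (hc θ hθ))).1.apply_unit hθ
  have uv := ((hu.mul hv).partial_derivs hJ (fun q hq => (du q hq).fun_mul (dv q hq))
    (fun θ hθ => (hc θ hθ).fun_mul (hsn θ hθ))).2.apply_unit hθ
  have vu := ((hv.mul hu).partial_derivs hJ (fun q hq => (dv q hq).fun_mul (du q hq))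
    (fun θ hθ => (hsn θ hθ).fun_mul (hc θ hθ))).1.apply_unit hθ
  have vv := ((hv.mul hv).partial_derivs hJ (fun q hq => (dv q hq).fun_mul (dv q hq))
    (fun θ hθ => (hsn θ hθ).fun_mul (hsn θ hθ))).2.apply_unit hθ
  obtain ⟨hpx, hpy⟩ := hp.partial_derivs hJ dp hP
  have px := hpx.apply_unit hθ
  have py := hpy.apply_unit hθ
  obtain ⟨e1, e2, -⟩ := hNS _ (unit_mem_cone hθ)
  rw [uu, uv, lu, px] at e1
  rw [vu, vv, lv, py] at e2
  push_cast at e1 e2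
  have h1 := sin_sq_add_cos_sq θ
  generalize sin θ = s at *
  generalize cos θ = c at *
  constructor
  · linear_combination -c * e1 - s * e2
      - (g θ ^ 2 * (s ^ 2 + c ^ 2 + 1) + g'' θ + 2 * P θ) * h1
  · linear_combination -s * e1 + c * e2 - (P' θ - 2 * g' θ) * h1

/-- A radial self-similar solution is `g / r` times the radial unit vector, where the angular
profile `g` solves the profile equation; the pressure is `(2 g + C₁) / r²`. -/
theorem IsRadialSelfSimilarSolution.exists_profile {J : Set ℝ} (hJ : IsOpen J)
    (hJc : IsPreconnected J) {u v p : ℝ × ℝ → ℝ}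
    (h : IsRadialSelfSimilarSolution (cone J) u v p) :
    ∃ C₁ g g', IsProfileSolution C₁ g g' J ∧ ∀ r θ : ℝ, 0 < r → θ ∈ J →
      u (r * cos θ, r * sin θ) = g θ / r * cos θ ∧
      v (r * cos θ, r * sin θ) = g θ / r * sin θ ∧
      p (r * cos θ, r * sin θ) = (2 * g θ + C₁) / r ^ 2 := by
  let g : ℝ → ℝ := fun θ => cos θ * u (cos θ, sin θ) + sin θ * v (cos θ, sin θ)
  let P : ℝ → ℝ := fun θ => p (cos θ, sin θ)
  have hray (r θ : ℝ) (hr : 0 < r) : r⁻¹ • ((r * cos θ, r * sin θ) : ℝ × ℝ) = (cos θ, sin θ) := by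
    simp [hr.ne']
  have hss (r θ : ℝ) (hr : 0 < r) (hθ : θ ∈ J) :=
    h.selfSimilar r⁻¹ (inv_pos.2 hr) _ (mem_cone hr hθ)
  have hrad (θ : ℝ) (hθ : θ ∈ J) := h.radial _ (unit_mem_cone hθ)
  have hu : IsHomogeneous J (-1) u fun θ => g θ * cos θ := by
    intro r θ hr hθ
    rw [(hss r θ hr hθ).1, hray r θ hr, zpow_neg_one]
    have := hrad θ hθ
    simp only [g] at this ⊢
    linear_combination -r⁻¹ * u (cos θ, sin θ) * sin_sq_add_cos_sq θ - r⁻¹ * sin θ * this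
  have hv : IsHomogeneous J (-1) v fun θ => g θ * sin θ := by
    intro r θ hr hθ
    rw [(hss r θ hr hθ).2.1, hray r θ hr, zpow_neg_one]
    have := hrad θ hθ
    simp only [g] at this ⊢
    linear_combination -r⁻¹ * v (cos θ, sin θ) * sin_sq_add_cos_sq θ + r⁻¹ * cos θ * this
  have hp : IsHomogeneous J (-2) p P := by
    intro r θ hr hθ
    rw [(hss r θ hr hθ).2.2, hray r θ hr, inv_pow, zpow_neg]
    norm_cast
  have hcirc : ContDiff ℝ ∞ fun θ : ℝ => (cos θ, sin θ) := contDiff_cos.prodMk contDiff_sin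
  have hmaps : MapsTo (fun θ : ℝ => (cos θ, sin θ)) J (cone J) := fun θ hθ => unit_mem_cone hθ
  have sg : ContDiffOn ℝ ∞ g J :=
    (contDiff_cos.contDiffOn.mul (h.smooth.1.comp hcirc.contDiffOn hmaps)).add
      (contDiff_sin.contDiffOn.mul (h.smooth.2.1.comp hcirc.contDiffOn hmaps))
  have sP : ContDiffOn ℝ ∞ P J := h.smooth.2.2.comp hcirc.contDiffOn hmaps
  have sg' : ContDiffOn ℝ ∞ (deriv g) J := sg.deriv_of_isOpen hJ (by simp)
  have hderiv {W : ℝ → ℝ} (hW : ContDiffOn ℝ ∞ W J) (θ : ℝ) (hθ : θ ∈ J) :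
      HasDerivAt W (deriv W θ) θ :=
    ((hW.contDiffAt (hJ.mem_nhds hθ)).differentiableAt (by simp)).hasDerivAt
  have hmom (θ : ℝ) (hθ : θ ∈ J) := radial_momentum hJ h.smooth h.solves hu hv hp
    (hderiv sg) (hderiv sg') (hderiv sP) hθ
  obtain ⟨C₁, hC⟩ := hJ.exists_is_const_of_deriv_eq_zero (f := fun θ => P θ - 2 * g θ) hJc
    (fun θ hθ => ((hderiv sP θ hθ).differentiableAt.sub
      ((hderiv sg θ hθ).differentiableAt.const_mul 2)).differentiableWithinAt)
    (fun θ hθ => by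
      rw [((hderiv sP θ hθ).fun_sub ((hderiv sg θ hθ).const_mul 2)).deriv, (hmom θ hθ).2]
      simp)
  have hPg (θ : ℝ) (hθ : θ ∈ J) : P θ = 2 * g θ + C₁ := by linarith [hC θ hθ]
  refine ⟨C₁, g, deriv g, fun θ hθ => ⟨hderiv sg θ hθ, ?_⟩, fun r θ hr hθ => ⟨?_, ?_, ?_⟩⟩
  · refine (hderiv sg' θ hθ).congr_deriv ?_
    rw [(hmom θ hθ).1, hPg θ hθ]
    ring
  · rw [hu r θ hr hθ, zpow_neg_one]
    ring
  · rw [hv r θ hr hθ, zpow_neg_one]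
    ring
  · rw [hp r θ hr hθ, hPg θ hθ, zpow_neg]
    norm_cast
    field_simp

/-! ### Solutions in the punctured plane -/

lemma exists_polar_eq {q : ℝ × ℝ} (hq : q ≠ 0) :
    ∃ r θ : ℝ, 0 < r ∧ q = (r * cos θ, r * sin θ) := by
  have hz : (⟨q.1, q.2⟩ : ℂ) ≠ 0 := fun h => hq (Prod.ext (congrArg Complex.re h)
    (congrArg Complex.im h))
  exact ⟨‖(⟨q.1, q.2⟩ : ℂ)‖, Complex.arg ⟨q.1, q.2⟩, norm_pos_iff.2 hz,
    Prod.ext (Complex.norm_mul_cos_arg ⟨q.1, q.2⟩).symm (Complex.norm_mul_sin_arg ⟨q.1, q.2⟩).symm⟩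

lemma puncturedPlane_eq_cone : puncturedPlane = cone univ := by
  ext q
  refine ⟨fun hq => ?_, ?_⟩
  · obtain ⟨r, θ, hr, he⟩ := exists_polar_eq hq
    exact ⟨r, hr, θ, trivial, he⟩
  · rintro ⟨r, hr, θ, -, rfl⟩ h0
    have h1 := rsq_polar r θ
    rw [h0] at h1
    have : (0 : ℝ) < r ^ 2 := by positivity
    simp [rsq] at h1
    exact this.ne h1

/-- A sector of opening `2 π` is dense in the punctured plane. -/
lemma eqOn_puncturedPlane_of_sector {θ₁ θ₂ : ℝ} (h : θ₂ - θ₁ = 2 * π) {E E' : ℝ × ℝ → ℝ}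
    (hE : ContinuousOn E puncturedPlane) (hE' : ContinuousOn E' puncturedPlane)
    (heq : EqOn E E' (sector θ₁ θ₂)) : EqOn E E' puncturedPlane := by
  intro q hq
  obtain ⟨r, θ, hr, rfl⟩ := exists_polar_eq hq
  obtain ⟨k, hk, -⟩ := existsUnique_add_zsmul_mem_Ico two_pi_pos θ θ₁
  obtain ⟨t, ht⟩ : ∃ t, t = θ + k • (2 * π) := ⟨_, rfl⟩
  rw [← ht] at hk
  have hray : ((r * cos θ, r * sin θ) : ℝ × ℝ) = (r * cos t, r * sin t) := by
    rw [ht, zsmul_eq_mul, cos_add_int_mul_two_pi, sin_add_int_mul_two_pi]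
  have hmaps : MapsTo (fun s : ℝ => (r * cos s, r * sin s)) univ puncturedPlane := by
    rw [puncturedPlane_eq_cone]
    exact fun s _ => mem_cone hr trivial
  have hc : ContinuousOn (fun s : ℝ => (r * cos s, r * sin s)) univ := by fun_prop
  have h1 := continuousOn_univ.1 (hE.comp hc hmaps)
  have h2 := continuousOn_univ.1 (hE'.comp hc hmaps)
  have hlt : θ₁ < θ₂ := by linarith [two_pi_pos]
  have hsub : closure (Ioo θ₁ θ₂) ⊆ {s | E (r * cos s, r * sin s) = E' (r * cos s, r * sin s)} :=
    closure_minimal (fun s hs => heq (mem_cone hr hs)) (isClosed_eq h1 h2)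
  rw [closure_Ioo hlt.ne] at hsub
  rw [hray]
  exact hsub ⟨hk.1, by linarith [hk.2]⟩

lemma eqOn_dX {D : Set (ℝ × ℝ)} (hD : IsOpen D) {w z : ℝ × ℝ → ℝ} (h : EqOn w z D) :
    EqOn (dX w) (dX z) D := fun q hq => by
  rw [dX, dX, (h.eventuallyEq_of_mem (hD.mem_nhds hq)).fderiv_eq]

lemma eqOn_dY {D : Set (ℝ × ℝ)} (hD : IsOpen D) {w z : ℝ × ℝ → ℝ} (h : EqOn w z D) :
    EqOn (dY w) (dY z) D := fun q hq => by
  rw [dY, dY, (h.eventuallyEq_of_mem (hD.mem_nhds hq)).fderiv_eq]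

/-- A smooth extension to the punctured plane of a solution in a sector of opening `2 π` is a
solution, because all the defining relations are closed. -/
lemma IsRadialSelfSimilarSolution.extend {θ₁ θ₂ : ℝ} (h : θ₂ - θ₁ = 2 * π)
    {u v p U V P : ℝ × ℝ → ℝ} (hs : IsRadialSelfSimilarSolution (sector θ₁ θ₂) u v p)
    (hsm : SmoothOn puncturedPlane U V P)
    (heq : ∀ q ∈ sector θ₁ θ₂, U q = u q ∧ V q = v q ∧ P q = p q) :
    IsRadialSelfSimilarSolution puncturedPlane U V P := by
  have hD : IsOpen (sector θ₁ θ₂) := isOpen_cone isOpen_Ioo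
  have hO : IsOpen puncturedPlane := puncturedPlane_eq_cone ▸ isOpen_cone isOpen_univ
  have eu : EqOn U u (sector θ₁ θ₂) := fun q hq => (heq q hq).1
  have ev : EqOn V v (sector θ₁ θ₂) := fun q hq => (heq q hq).2.1
  have ep : EqOn P p (sector θ₁ θ₂) := fun q hq => (heq q hq).2.2
  obtain ⟨sU, sV, sP⟩ := hsm
  have dense {E E' : ℝ × ℝ → ℝ} (hE : ContDiffOn ℝ ∞ E puncturedPlane)
      (hE' : ContDiffOn ℝ ∞ E' puncturedPlane) (heq : EqOn E E' (sector θ₁ θ₂)) :=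
    eqOn_puncturedPlane_of_sector h hE.continuousOn hE'.continuousOn heq
  have hmul {w w' z z' : ℝ × ℝ → ℝ} (hw : EqOn w w' (sector θ₁ θ₂))
      (hz : EqOn z z' (sector θ₁ θ₂)) :
      EqOn (fun q => w q * z q) (fun q => w' q * z' q) (sector θ₁ θ₂) :=
    fun q hq => by simp only [hw hq, hz hq]
  have hsmul {s : ℝ} (hs : 0 < s) {w : ℝ × ℝ → ℝ} (hw : ContDiffOn ℝ ∞ w puncturedPlane) :
      ContDiffOn ℝ ∞ (fun q => w (s • q)) puncturedPlane :=
    hw.comp (contDiff_const_smul s).contDiffOn fun q hq => smul_ne_zero hs.ne' hq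
  have hsector {s : ℝ} (hs : 0 < s) {q : ℝ × ℝ} (hq : q ∈ sector θ₁ θ₂) :
      s • q ∈ sector θ₁ θ₂ := by
    obtain ⟨r, hr, θ, hθ, rfl⟩ := hq
    exact ⟨s * r, mul_pos hs hr, θ, hθ, by simp [mul_assoc]⟩
  refine ⟨⟨sU, sV, sP⟩, fun q hq => ⟨?_, ?_, ?_⟩, fun s hs' q hq => ⟨?_, ?_, ?_⟩, ?_⟩
  · refine dense (E := fun q => dX (fun z => U z * U z) q + dY (fun z => U z * V z) q
      - (dX (dX U) q + dY (dY U) q) + dX P q) ?_ contDiffOn_const (fun x hx => ?_) hq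
    · exact (((contDiffOn_dX hO (sU.mul sU)).add (contDiffOn_dY hO (sU.mul sV))).sub
        ((contDiffOn_dX hO (contDiffOn_dX hO sU)).add
          (contDiffOn_dY hO (contDiffOn_dY hO sU)))).add (contDiffOn_dX hO sP)
    · dsimp only
      rw [eqOn_dX hD (hmul eu eu) hx, eqOn_dY hD (hmul eu ev) hx, eqOn_dX hD (eqOn_dX hD eu) hx,
        eqOn_dY hD (eqOn_dY hD eu) hx, eqOn_dX hD ep hx]
      exact (hs.solves x hx).1
  · refine dense (E := fun q => dX (fun z => V z * U z) q + dY (fun z => V z * V z) q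
      - (dX (dX V) q + dY (dY V) q) + dY P q) ?_ contDiffOn_const (fun x hx => ?_) hq
    · exact (((contDiffOn_dX hO (sV.mul sU)).add (contDiffOn_dY hO (sV.mul sV))).sub
        ((contDiffOn_dX hO (contDiffOn_dX hO sV)).add
          (contDiffOn_dY hO (contDiffOn_dY hO sV)))).add (contDiffOn_dY hO sP)
    · dsimp only
      rw [eqOn_dX hD (hmul ev eu) hx, eqOn_dY hD (hmul ev ev) hx, eqOn_dX hD (eqOn_dX hD ev) hx,
        eqOn_dY hD (eqOn_dY hD ev) hx, eqOn_dY hD ep hx]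
      exact (hs.solves x hx).2.1
  · refine dense (E := fun q => dX U q + dY V q) ((contDiffOn_dX hO sU).add (contDiffOn_dY hO sV))
      contDiffOn_const (fun x hx => ?_) hq
    dsimp only
    rw [eqOn_dX hD eu hx, eqOn_dY hD ev hx]
    exact (hs.solves x hx).2.2
  · refine dense sU (contDiffOn_const.mul (hsmul hs' sU)) (fun x hx => ?_) hq
    dsimp only
    rw [eu hx, eu (hsector hs' hx)]
    exact (hs.selfSimilar s hs' x hx).1
  · refine dense sV (contDiffOn_const.mul (hsmul hs' sV)) (fun x hx => ?_) hq
    dsimp only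
    rw [ev hx, ev (hsector hs' hx)]
    exact (hs.selfSimilar s hs' x hx).2.1
  · refine dense sP (contDiffOn_const.mul (hsmul hs' sP)) (fun x hx => ?_) hq
    dsimp only
    rw [ep hx, ep (hsector hs' hx)]
    exact (hs.selfSimilar s hs' x hx).2.2
  · refine fun q hq => dense (contDiffOn_fst.mul sV) (contDiffOn_snd.mul sU) (fun x hx => ?_) hq
    dsimp only
    rw [ev hx, eu hx]
    exact hs.radial x hx

/-- The bounded profile returns to its maximum only after an integral number of periods
`2 K(k)` of the argument. -/
lemma exists_period_of_profile3_eq {a b c : ℝ} (hab : a < b) (hbc : b < c)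
    (h : profile3 a b c 0 (2 * π) = profile3 a b c 0 0) :
    ∃ n : ℕ, 0 < n ∧ π * √((c - a) / 6) = n * ellipticK (√((c - b) / (c - a))) := by
  obtain ⟨-, hk1⟩ := modulus_sq hab hbc
  obtain ⟨-, hν0⟩ := frequency_sq hab hbc
  rw [profile3_zero_apply, profile3_zero_apply, mul_zero, jacobiAm_zero hk1, sin_zero] at h
  have hsin : sin (jacobiAm (√((c - a) / 6) * (2 * π)) (√((c - b) / (c - a)))) = 0 := by
    have : (c - b) * sin (jacobiAm (√((c - a) / 6) * (2 * π)) (√((c - b) / (c - a)))) ^ 2 = 0 := by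
      linarith
    simpa [(sub_pos.2 hbc).ne'] using this
  obtain ⟨j, hj⟩ := sin_eq_zero_iff.1 hsin
  have hF := congrArg (fun φ => ellipticF φ (√((c - b) / (c - a)))) hj
  rw [ellipticF_int_mul_pi hk1, ellipticF_jacobiAm hk1] at hF
  have hK := ellipticK_pos hk1
  have hj0 : 0 < j := by
    have h1 : (0 : ℝ) < j * (2 * ellipticK (√((c - b) / (c - a)))) := by
      rw [hF]
      positivity
    exact_mod_cast pos_of_mul_pos_left h1 (by positivity)
  lift j to ℕ using hj0.le
  refine ⟨j, by exact_mod_cast hj0, ?_⟩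
  push_cast at hF
  linarith

/-- Radial self-similar solutions in the punctured plane are Jeffery–Hamel solutions: the angular
profile is periodic and has no pole, which leaves the constants and the bounded elliptic
profile. -/
theorem IsRadialSelfSimilarSolution.isRadialJefferyHamel {U V P : ℝ × ℝ → ℝ}
    (h : IsRadialSelfSimilarSolution puncturedPlane U V P) : IsRadialJefferyHamel U V P := by
  rw [puncturedPlane_eq_cone] at h
  obtain ⟨C₁, g, g', hg, hUVP⟩ := h.exists_profile isOpen_univ isPreconnected_univ
  have hper (t : ℝ) : g (t + 2 * π) = g t := by
    have e1 := hUVP 1 t one_pos trivial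
    have e2 := hUVP 1 (t + 2 * π) one_pos trivial
    rw [cos_add_two_pi, sin_add_two_pi] at e2
    have c1 := e2.1.symm.trans e1.1
    have c2 := e2.2.1.symm.trans e1.2.1
    linear_combination cos t * c1 + sin t * c2 - (g (t + 2 * π) - g t) * sin_sq_add_cos_sq t
  rcases hg.eq_const_or_translate isOpen_univ isPreconnected_univ univ_nonempty with
    ⟨A, hA, hgA⟩ | ⟨C₂, S, f, -, halt, τ, hτ⟩
  · left
    refine ⟨A, fun q hq => ?_⟩
    obtain ⟨r, θ, hr, rfl⟩ := exists_polar_eq hq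
    obtain ⟨e1, e2, e3⟩ := hUVP r θ hr trivial
    rw [e1, e2, e3, rsq_polar, hgA θ trivial]
    refine ⟨by field_simp, by field_simp, ?_⟩
    field_simp
    linarith
  · right
    rcases halt with ⟨s, hs⟩ | honce | ⟨a, b, c, hr, hab, hbc, ha, hb, hc, rfl⟩
    · have := (hτ (s - τ) trivial).1
      rw [sub_add_cancel] at this
      exact absurd hs this
    · have e1 := (hτ (-τ) trivial).2
      have e2 := (hτ (-τ + 2 * π) trivial).2
      rw [hper, e1, neg_add_cancel, neg_add_cancel_comm] at e2
      exact absurd (honce _ e2.symm) two_pi_pos.ne'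
    · have hret : profile3 a b c 0 (2 * π) = profile3 a b c 0 0 := by
        have e1 := (hτ (-τ) trivial).2
        have e2 := (hτ (-τ + 2 * π) trivial).2
        rw [hper, e1, neg_add_cancel, neg_add_cancel_comm] at e2
        exact e2.symm
      obtain ⟨n, hn, hK⟩ := exists_period_of_profile3_eq hab hbc hret
      have hF := profile3_translate (b := b) (hab.trans hbc) τ
      refine ⟨n, C₁, 0, profile3 a b c (√((c - a) / 6) / √(c - a) * τ), hn,
        ⟨C₂, a, b, c, _, hr, hab, hbc, ha, hb, hc, hK, rfl⟩, fun t => ?_,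
        ?_, fun r θ hr => ?_⟩
      · rw [hF, hF, add_right_comm, profile3_periodic hab hbc hn hK]
      · simp only [hF]
        exact profile3_flux_lt hab hbc hn ha hb hc hK τ
      · rw [sub_zero, hF, ← (hτ θ trivial).2, ← add_div]
        exact hUVP r θ hr trivial

/-- An interval longer than `π` contains directions in the right half-plane. -/
lemma exists_int_overlap {θ₁ θ₂ : ℝ} (h : π < θ₂ - θ₁) :
    ∃ k : ℤ, max θ₁ (2 * π * k - π / 2) < min θ₂ (2 * π * k + π / 2) := by
  obtain ⟨k, hk⟩ : ∃ k : ℤ, k = ⌈(θ₂ + π / 2) / (2 * π)⌉ - 1 := ⟨_, rfl⟩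
  have h1 : (k : ℝ) < (θ₂ + π / 2) / (2 * π) := by
    have := Int.ceil_lt_add_one ((θ₂ + π / 2) / (2 * π))
    rw [hk]
    push_cast
    linarith
  have h2 : (θ₂ + π / 2) / (2 * π) ≤ k + 1 := by
    have := Int.le_ceil ((θ₂ + π / 2) / (2 * π))
    rw [hk]
    push_cast
    linarith
  rw [lt_div_iff₀ two_pi_pos] at h1
  rw [div_le_iff₀ two_pi_pos] at h2
  refine ⟨k, ?_⟩
  rw [max_lt_iff, lt_min_iff, lt_min_iff]
  refine ⟨⟨?_, ?_⟩, ?_, ?_⟩ <;> linarith [pi_pos]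

end JefferyHamel

open JefferyHamel in
theorem theorem1p5 (θ₁ θ₂ : ℝ) (hπ : π < θ₂ - θ₁) (h2π : θ₂ - θ₁ ≤ 2 * π)
    (u v p : ℝ × ℝ → ℝ)
    (hsol : IsRadialSelfSimilarSolution (sector θ₁ θ₂) u v p)
    (hnontriv : ∃ q ∈ sector θ₁ θ₂, (u q, v q) ≠ (0, 0)) :
    (∃ (C₁ C₂ : ℝ) (f : ℝ → ℝ) (κ : ℝ × ℝ → ℝ),
      IsTableProfile C₁ C₂ f ∧
      (∀ q ∈ sector θ₁ θ₂,
        u q = q.1 / rsq q * κ q ∧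
        v q = q.2 / rsq q * κ q ∧
        p q = 2 / rsq q * κ q + C₁ / rsq q) ∧
      AnalyticOnNhd ℝ κ (sector θ₁ θ₂) ∧
      (∃ a b : ℝ, a < b ∧ sector a b ⊆ sector θ₁ θ₂ ∧
        ∀ q ∈ sector a b, 0 < q.1 ∧ κ q = f (arctan (q.2 / q.1))) ∧
      (∃ k : ℤ, ∀ r θ : ℝ, 0 < r → θ ∈ Ioo θ₁ θ₂ →
        κ (r * cos θ, r * sin θ) = f (θ - 2 * π * k))) ∧
    (∀ U V P : ℝ × ℝ → ℝ,
      SmoothOn puncturedPlane U V P →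
      (∀ q ∈ sector θ₁ θ₂, U q = u q ∧ V q = v q ∧ P q = p q) →
      (θ₂ - θ₁ < 2 * π → IsRadialSelfSimilarSolution puncturedPlane U V P) →
      IsRadialJefferyHamel U V P) := by
  constructor
  · obtain ⟨C₁, g, g', hg, huvp⟩ := IsRadialSelfSimilarSolution.exists_profile
      isOpen_Ioo isPreconnected_Ioo (sector_eq_cone θ₁ θ₂ ▸ hsol)
    obtain ⟨k, hk⟩ := exists_int_overlap hπ
    -- the principal branch of `arctan (y / x)` is the angle minus `2 π k`
    have hset : {t | t + 2 * π * k ∈ Ioo θ₁ θ₂} = Ioo (θ₁ - 2 * π * k) (θ₂ - 2 * π * k) := by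
      ext t
      simp only [mem_ofPred_eq, mem_Ioo, sub_lt_iff_lt_add, lt_sub_iff_add_lt]
    have hshift := hg.comp_add_const (τ := 2 * π * k)
    rw [hset] at hshift
    obtain ⟨C₂, f, hf, hgf⟩ := hshift.exists_tableProfile isOpen_Ioo isPreconnected_Ioo
      (nonempty_Ioo.2 (by linarith [pi_pos]))
    have hgf' (θ : ℝ) (hθ : θ ∈ Ioo θ₁ θ₂) : g θ = f (θ - 2 * π * k) ∧ AnalyticAt ℝ g θ := by
      obtain ⟨h1, h2⟩ := hgf (θ - 2 * π * k) ⟨by linarith [hθ.1], by linarith [hθ.2]⟩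
      rw [sub_add_cancel] at h1
      refine ⟨h1, ?_⟩
      have := h2.comp (f := fun t => t - 2 * π * k) (x := θ) (by fun_prop)
      simpa [Function.comp_def] using this
    let κ : ℝ × ℝ → ℝ := fun q => q.1 * u q + q.2 * v q
    have hκ (r θ : ℝ) (hr : 0 < r) (hθ : θ ∈ Ioo θ₁ θ₂) : κ (r * cos θ, r * sin θ) = g θ := by
      obtain ⟨e1, e2, -⟩ := huvp r θ hr hθ
      simp only [κ]
      rw [e1, e2]
      field_simp
      linear_combination g θ * sin_sq_add_cos_sq θ
    refine ⟨C₁, C₂, f, κ, hf, ?_, ?_, ?_, k, fun r θ hr hθ => ?_⟩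
    · rintro q ⟨r, hr, θ, hθ, rfl⟩
      obtain ⟨e1, e2, e3⟩ := huvp r θ hr hθ
      rw [hκ r θ hr hθ, rsq_polar, e1, e2, e3]
      refine ⟨?_, ?_, ?_⟩ <;> field_simp
    · rintro q ⟨r, hr, θ, hθ, rfl⟩
      have hcomp : AnalyticAt ℝ (fun q => g (localAngle θ q)) (r * cos θ, r * sin θ) := by
        refine AnalyticAt.comp ?_ (analyticAt_localAngle hr θ)
        rw [localAngle_ray]
        exact (hgf' θ hθ).2
      refine hcomp.congr ?_
      filter_upwards [eventually_polar isOpen_Ioo hr hθ] with q ⟨hp, hmem, he⟩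
      rw [← hκ _ _ hp hmem]
      exact congrArg κ he.symm
    · refine ⟨_, _, hk, ?_, ?_⟩
      · rintro q ⟨r, hr, θ, hθ, rfl⟩
        exact mem_cone hr ⟨(le_max_left _ _).trans_lt hθ.1, hθ.2.trans_le (min_le_left _ _)⟩
      · rintro q ⟨r, hr, θ, hθ, rfl⟩
        have hθ1 : θ ∈ Ioo θ₁ θ₂ :=
          ⟨(le_max_left _ _).trans_lt hθ.1, hθ.2.trans_le (min_le_left _ _)⟩
        have hl : -(π / 2) < θ - 2 * π * k := by linarith [(le_max_right _ _).trans_lt hθ.1]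
        have hu : θ - 2 * π * k < π / 2 := by linarith [hθ.2.trans_le (min_le_right _ _)]
        have hcos : cos (θ - 2 * π * k) = cos θ := by
          rw [mul_comm (2 * π) (k : ℝ), cos_sub_int_mul_two_pi]
        have hsin : sin (θ - 2 * π * k) = sin θ := by
          rw [mul_comm (2 * π) (k : ℝ), sin_sub_int_mul_two_pi]
        have hpos : 0 < cos θ := hcos ▸ cos_pos_of_mem_Ioo ⟨hl, hu⟩
        refine ⟨mul_pos hr hpos, ?_⟩
        rw [hκ r θ hr hθ1, (hgf' θ hθ1).1, mul_div_mul_left _ _ hr.ne', ← hsin, ← hcos,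
          ← tan_eq_sin_div_cos, arctan_tan hl hu]
    · rw [hκ r θ hr hθ, (hgf' θ hθ).1]
  · intro U V P hsm heq hlt
    rcases h2π.lt_or_eq with h | h
    · exact (hlt h).isRadialJefferyHamel
    · exact (hsol.extend h hsm heq).isRadialJefferyHamel
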